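/- Let $R$ be a real closed field, $K\subset R$ a subfield, and $u=(u_1,\dots,u_k)$. Let $p\ge 1$ and let $P=y^p+\sum_{0\le h\le p-1}C_h\,y^h\in K[u,y]$ with $C_h\in K[u]$. Write $P^{(h)}$ for the $h$-th derivative of $P$ with respect to $y$. **Elimination family.** For $A\in K[u,y]$ let ${\rm Her}(P;A)$ be the $p\times p$ Hermite matrix with entries ${\rm Tr}(A\,y^{i+j})$, $0\le i,j\le p-1$, where ${\rm Tr}(B)$ is the trace of multiplication by $B$ on $K[u][y]/(P)$, and let ${\rm HMi}(P;A)\subset K[u]$ be the set of its leading principal minors of sizes $1,\dots,p$. Let ${\rm bit}(p)$ be the number of binary digits of $p$, let ${\rm PDer}(P)$ be the set of products $\prod_{1\le h\le p-1}(P^{(h)})^{\alpha_h}$ with $\alpha_h\in\{0,1,2\}$ and at most ${\rm bit}(p)$ indices $h$ with $\alpha_h\ne0$, and put ${\rm ThElim}(P)=\bigcup_{A\in{\rm PDer}(P)}{\rm HMi}(P;A)\subset K[u]$. A sign condition on ${\rm ThElim}(P)$ is a map $\tau:{\rm ThElim}(P)\to\{-1,0,1\}$; its realization ${\rm Real}(\tau,R)$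 is the set of $\upsilon\in R^k$ with ${\rm sign}(H(\upsilon))=\tau(H)$ for all $H\in{\rm ThElim}(P)$, and $\tau$ is realizable if ${\rm Real}(\tau,R)\neq\emptyset$. **Multiplicity data.** Let $\Lambda_m$ be the set of non-increasing finite lists of positive integers with sum $m$ (so $\Lambda_0$ contains only the empty list), and let $\#$ denote the length of a list. **Thom encodings.** A sign condition on ${\rm Der}(P)$ is a map $\eta:\{1,\dots,p-1\}\to\{-1,0,1\}$, extended by $\eta_+(0)=0$, $\eta_+(h)=\eta(h)$ for $1\le h\le p-1$, and $\eta_+(p)=1$. Let ${\rm mu}(\eta)$ be the smallest $i$ with $\eta_+(i)\ne0$. Write $\eta\prec_P\eta'$ if $\eta_+\ne\eta'_+$ and, $q$ being the largest index with $\eta_+(q)\neq\eta'_+(q)$, either $\eta_+(q)<\eta'_+(q)$ and $\eta_+(q+1)=1$, or $\eta_+(q)>\eta'_+(q)$ and $\eta_+(q+1)=-1$. Write $\eta\prec_P^{\rm mu}\eta'$ if ${\rm mu}(\eta)>{\rm mu}(\eta')$, or ${\rm mu}(\eta)={\rm mu}(\eta')$ and $\eta\prec_P\eta'$. **Theorem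 (Fixing the Thom encodings).** For every realizable sign condition $\tau$ on ${\rm ThElim}(P)$ there exist a unique pair $(\mu,\nu)\in\Lambda_m\times\Lambda_n$ with $m+2n=p$ and a unique list $\eta=[\eta_1,\dots,\eta_{\#\mu}]$ of distinct sign conditions on ${\rm Der}(P)$, ordered with respect to $\prec_P^{\rm mu}$ (that is, $\eta_j\prec_P^{\rm mu}\eta_{j'}$ for $j<j'$), such that for every $\upsilon\in{\rm Real}(\tau,R)$ there exist $\theta\in R^{\#\mu}$ and $\alpha,\beta\in R^{\#\nu}$ with $$P(\upsilon,y)=\prod_{j=1}^{\#\mu}(y-\theta_j)^{\mu_j}\cdot\prod_{k=1}^{\#\nu}\big((y-\alpha_k)^2+\beta_k^2\big)^{\nu_k},$$ where the $\theta_j$ are pairwise distinct, every $\beta_k\neq0$, and for $k\ne k'$ the resultant $\big((\alpha_k-\alpha_{k'})^2+(\beta_k-\beta_{k'})^2\big)\big((\alpha_k-\alpha_{k'})^2+(\beta_k+\beta_{k'})^2\big)$ of the $k$-th and $k'$-th quadratic factors is nonzero, and with $${\rm sign}\big(P^{(h)}(\upsilon,\theta_j)\big)=\eta_j(h)\qquad(1\le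 j\le\#\mu,\ 1\le h\le p-1).$$ The uniqueness is that of the triple $(\mu,\nu,\eta)$ with these properties. -/

import Mathlib

open Polynomial

namespace ThomFix

section Elimination

variable {S : Type*} [CommRing S]

/-- The Hermite matrix `Her(P; Q)` of a monic polynomial `P` of degree `p` over `S`: for
`0 ≤ i, j < p`, its `(i, j)` entry is the trace of the multiplication by `Q(y) y ^ (i + j)`
on `S[y] / (P)`. -/
noncomputable def hermiteMatrix (P Q : S[X]) :
    Matrix (Fin P.natDegree) (Fin P.natDegree) S :=
  Matrix.of fun i j =>
    Algebra.trace S (AdjoinRoot P) (AdjoinRoot.mk P (Q * X ^ ((i : ℕ) + (j : ℕ))))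

/-- `HMi(P; Q)`: the set of the `p` leading principal minors (of sizes `1, …, p`) of the Hermite
matrix `Her(P; Q)`, where `p = deg P`. -/
def HMi (P Q : S[X]) : Set S :=
  {H | ∃ (n : ℕ) (_ : 1 ≤ n) (hn : n ≤ P.natDegree),
    H = ((hermiteMatrix P Q).submatrix (Fin.castLE hn) (Fin.castLE hn)).det}

/-- `PDer_i(P)`: the products `∏_{1 ≤ h ≤ p - 1} (P^(h)) ^ α_h` with `α_h ∈ {0, 1, 2}` and at most
`i` indices `h` with `α_h ≠ 0`. -/
def PDer (i : ℕ) (P : S[X]) : Set S[X] :=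
  {A | ∃ α : Finset.Icc 1 (P.natDegree - 1) → Fin 3,
    (Finset.univ.filter fun h : ↥(Finset.Icc 1 (P.natDegree - 1)) => α h ≠ 0).card ≤ i ∧
    A = ∏ h : ↥(Finset.Icc 1 (P.natDegree - 1)), (derivative^[(h : ℕ)] P) ^ (α h : ℕ)}

/-- `ThElim(P)`: the union of the sets `HMi(P; A)` for `A ∈ PDer_{bit(p)}(P)`, where `p = deg P`
and `bit(p)` is the number of binary digits of `p`, that is, `2 ^ (bit(p) - 1) ≤ p < 2 ^ bit(p)`. -/
def ThElim (P : S[X]) : Set S :=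
  ⋃ A ∈ PDer (Nat.size P.natDegree) P, HMi P A

end Elimination

section SignConditions

/-- A sign condition on a set `F` of polynomials in `K[u₁, …, uₖ]`. -/
abbrev SignCondition {K : Type*} [Field K] {k : ℕ} (F : Set (MvPolynomial (Fin k) K)) : Type _ :=
  F → SignType

/-- `Real(τ, R)`: the points of `R ^ k` at which every `H ∈ F` has sign `τ(H)`. -/
def realization {K : Type*} [Field K] {k : ℕ} {F : Set (MvPolynomial (Fin k) K)}
    (R : Type*) [Field R] [LinearOrder R] [Algebra K R] (τ : SignCondition F) :
    Set (Fin k → R) :=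
  {υ | ∀ H : F, SignType.sign (MvPolynomial.aeval υ (H : MvPolynomial (Fin k) K)) = τ H}

/-- The polynomial `P(υ, y) ∈ R[y]` obtained from `P ∈ K[u][y]` by the substitution `u = υ`. -/
noncomputable def specialize {K R : Type*} [Field K] [Field R] [Algebra K R] {k : ℕ}
    (P : (MvPolynomial (Fin k) K)[X]) (υ : Fin k → R) : R[X] :=
  P.map ((MvPolynomial.aeval υ : MvPolynomial (Fin k) K →ₐ[K] R) : MvPolynomial (Fin k) K →+* R)

/-- Sign conditions on the list `Der(P)` of the first `p - 1` derivatives of a polynomial `P` of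
degree `p`, indexed by the orders `1, …, p - 1` of the derivatives. -/
abbrev DerSign (p : ℕ) : Type :=
  Finset.Icc 1 (p - 1) → SignType

/-- The extension `η₊` of a sign condition `η` on `Der(P)`, for `P` monic of degree `p ≥ 1`, by
`η₊(0) = 0` and `η₊(p) = sign(1) = 1`. Only the values at `0, …, p` are meaningful. -/
def DerSign.plus {p : ℕ} (η : DerSign p) : ℕ → SignType := fun h =>
  if h = 0 then 0 else if hh : h ∈ Finset.Icc 1 (p - 1) then η ⟨h, hh⟩ else 1

/-- The multiplicity `mu(η, P)`: the smallest `i`, `0 ≤ i ≤ p`, with `η₊(i) ≠ 0`. -/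
noncomputable def DerSign.mu {p : ℕ} (η : DerSign p) : ℕ :=
  sInf {i | η.plus i ≠ 0}

/-- The relation `η₁ ≺_P η₂` for sign conditions on `Der₊(P)` (extended to the index `p`), where
`P` has degree `p`: at the largest index `q < p` where they differ, either `η₁(q) < η₂(q)` and
`η₁(q + 1) = 1`, or `η₁(q) > η₂(q)` and `η₁(q + 1) = -1`. -/
def ThomLT (p : ℕ) (η₁ η₂ : ℕ → SignType) : Prop :=
  ∃ q < p, η₁ q ≠ η₂ q ∧ (∀ h, q < h → h < p → η₁ h = η₂ h) ∧
    ((η₁ q < η₂ q ∧ η₁ (q + 1) = 1) ∨ (η₂ q < η₁ q ∧ η₁ (q + 1) = -1))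

/-- The order `≺_P^mu` on sign conditions on `Der(P)`: decreasing multiplicity first, then
`≺_P`. -/
def ThomMuLT {p : ℕ} (η₁ η₂ : DerSign p) : Prop :=
  η₂.mu < η₁.mu ∨ (η₁.mu = η₂.mu ∧ ThomLT p η₁.plus η₂.plus)

/-- `Λ_m`: the non-increasing lists of positive integers with sum `m`. -/
def Lam (m : ℕ) : Set (List ℕ) :=
  {μ | (∀ i ∈ μ, 1 ≤ i) ∧ μ.Pairwise (· ≥ ·) ∧ μ.sum = m}

end SignConditions

section Systems

variable {R : Type*} [Field R]

/-- `R(z, z')` for `z = a + i b`, `z' = a' + i b'`: the resultant of the quadratic polynomials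
`(y - a) ^ 2 + b ^ 2` and `(y - a') ^ 2 + b' ^ 2`. -/
def quadRes (a b a' b' : R) : R :=
  ((a - a') ^ 2 + (b - b') ^ 2) * ((a - a') ^ 2 + (b + b') ^ 2)

/-- The system `Fact(P)^{μ, ν}(θ, α + i β)`: `P` is the product of the `(y - θ_j) ^ μ_j` and of the
`((y - α_k) ^ 2 + β_k ^ 2) ^ ν_k`, the `θ_j` are pairwise distinct, the `β_k` are nonzero and the
quadratic factors are pairwise coprime. -/
structure FactSystem (F : R[X]) (μ ν : List ℕ) (θ : Fin μ.length → R) (α β : Fin ν.length → R) :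
    Prop where
  eq_prod : F = (∏ j, (X - C (θ j)) ^ μ.get j) *
    ∏ k, ((X - C (α k)) ^ 2 + C (β k) ^ 2) ^ ν.get k
  real_ne : ∀ j j', j < j' → θ j ≠ θ j'
  im_ne : ∀ k, β k ≠ 0
  res_ne : ∀ k k', k < k' → quadRes (α k) (β k) (α k') (β k') ≠ 0

/-- The system `Th(P)^{μ, ν, η}(θ, α + i β)`, where `P` has degree `p` and `#μ = #η`: the system
`Fact(P)^{μ, ν}(θ, α + i β)`, and `Der(P)(θ_j)` has the signs `η_j` for every `j`. -/
structure ThSystem [LinearOrder R] {p : ℕ} (F : R[X]) (μ ν : List ℕ) (η : List (DerSign p))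
    (θ : Fin μ.length → R) (α β : Fin ν.length → R) : Prop where
  fact : FactSystem F μ ν θ α β
  length_eq : μ.length = η.length
  sign_eq : ∀ (j : Fin μ.length) (h : Finset.Icc 1 (p - 1)),
    SignType.sign ((derivative^[(h : ℕ)] F).eval (θ j)) = η.get (Fin.cast length_eq j) h

end Systems

end ThomFix

/-! The data sought at a point `υ` are read off the roots of F = P(υ, y) in R(i). By the trace
formula, the Hermite form f ↦ Tr(A f²) is the sum of m_z A(z) f(z)² over the distinct roots z, with
m_z the multiplicity. Its rank is therefore the number of z with A(z) ≠ 0. A conjugate pair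
contributes a hyperbolic plane or nothing, so the signature is the sum of sign A(θ) over the
distinct real roots θ (`FactSystem.exists_diagonalization`).

The form is given by a Hankel matrix whose minor of size equal to the rank is nonzero, by a
Vandermonde factorization. For such a form the signs of the leading minors determine the signature
even when some of them vanish (Frobenius' rule, `exists_hasNonnegSubspace_of_sign_eq`). Traces
commute with specialization, so `τ` fixes the rank and the signature for every A in PDer(P).

Let A run through the products of powers of derivatives. The signatures are then the moments of the
multiset of Thom encodings of the real roots, and the ranks are the moments of the multiset of
vanishing patterns at all complex roots. A multiset of fewer than 2^w sign vectors is determined by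
its moments involving at most w coordinates (`eq_of_moments_eq`). Taking w = bit(p) suffices, as
there are at most p < 2^bit(p) distinct roots. The first multiset yields η, hence μ, because mu of
an encoding is the multiplicity of the root. The second yields the multiset of all complex
multiplicities, which is μ together with ν twice, hence ν.

Existence at one point uses that irreducible polynomials over R have degree at most 2
(`irreducible_eq_quadratic`), together with Thom's lemma (`thomLT_thomEncoding`): distinct real
roots have comparable encodings. The order is asymmetric, so a multiset of encodings has at most one
sorted list. -/

namespace ThomFix

/-! ### Real closed fields: R(i), irreducible polynomials, Rolle and monotonicity. -/

section RealClosed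

variable {R : Type*} [Field R] [LinearOrder R] [IsStrictOrderedRing R] [IsRealClosed R]

/-- With n the modulus of a + ib, take c² = (n + a)/2 and d² = (n - a)/2. Then 2cd = ±b, and the
sign of d is free. -/
theorem exists_complex_sqrt (a b : R) : ∃ c d : R, c ^ 2 - d ^ 2 = a ∧ 2 * c * d = b := by
  obtain ⟨n, hn⟩ := IsRealClosed.exists_eq_pow_of_nonneg
    (show (0 : R) ≤ a ^ 2 + b ^ 2 by positivity) two_ne_zero
  wlog hn0 : 0 ≤ n generalizing n
  · exact this (-n) (by rw [hn]; ring) (by linarith)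
  have h1 : |a| ≤ n := abs_le_of_sq_le_sq (by nlinarith [sq_nonneg b]) hn0
  obtain ⟨h1a, h1b⟩ := abs_le.mp h1
  obtain ⟨c, hc⟩ := IsRealClosed.exists_eq_pow_of_nonneg
    (show (0 : R) ≤ (n + a) / 2 by linarith) two_ne_zero
  obtain ⟨d, hd⟩ := IsRealClosed.exists_eq_pow_of_nonneg
    (show (0 : R) ≤ (n - a) / 2 by linarith) two_ne_zero
  have h2 : (2 * c * d) ^ 2 = b ^ 2 := by
    have : (2 * c * d) ^ 2 = 4 * c ^ 2 * d ^ 2 := by ring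
    rw [this, ← hc, ← hd]; linear_combination -hn
  rcases sq_eq_sq_iff_eq_or_eq_neg.mp h2 with h | h
  · exact ⟨c, d, by rw [← hc, ← hd]; ring, h⟩
  · exact ⟨c, -d, by rw [neg_sq, ← hc, ← hd]; ring, by rw [mul_neg, h, neg_neg]⟩

theorem finrank_eq_one_of_odd {E : Type*} [Field E] [Algebra R E] [FiniteDimensional R E]
    (h : Odd (Module.finrank R E)) : Module.finrank R E = 1 := by
  obtain ⟨x, hx⟩ := Field.exists_primitive_element R E
  have hint : IsIntegral R x := IsIntegral.of_finite R x
  have hdeg : (minpoly R x).natDegree = Module.finrank R E := by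
    rw [← IntermediateField.adjoin.finrank hint, hx, IntermediateField.finrank_top']
  obtain ⟨r, hr⟩ := IsRealClosed.exists_isRoot_of_odd_natDegree (f := minpoly R x) (hdeg ▸ h)
  rw [← hdeg]
  exact natDegree_eq_of_degree_eq_some
    (degree_eq_one_of_irreducible_of_root (minpoly.irreducible hint) hr)

/-- The fixed field of a Sylow 2-subgroup has odd degree over R, namely the index of the subgroup,
so it equals R and the subgroup is the whole group. -/
theorem card_galois_eq_two_pow {E : Type*} [Field E] [Algebra R E] [FiniteDimensional R E]
    [IsGalois R E] : ∃ n, Nat.card (E ≃ₐ[R] E) = 2 ^ n := by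
  have : Fact (Nat.Prime 2) := ⟨Nat.prime_two⟩
  obtain ⟨P⟩ : Nonempty (Sylow 2 (E ≃ₐ[R] E)) := inferInstance
  have h1 : ¬ 2 ∣ P.index := P.not_dvd_index
  have h2 := IntermediateField.finrank_fixedField_eq_card (F := R) (E := E) (P : Subgroup _)
  have h3 : Module.finrank R (IntermediateField.fixedField (P : Subgroup (E ≃ₐ[R] E))) *
      Module.finrank (IntermediateField.fixedField (P : Subgroup (E ≃ₐ[R] E))) E =
      Module.finrank R E := Module.finrank_mul_finrank _ _ _
  have h4 := IsGalois.card_aut_eq_finrank R E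
  have h5 := (P : Subgroup (E ≃ₐ[R] E)).card_mul_index
  have h6 : 0 < Nat.card P := Nat.card_pos
  have h7 : Module.finrank R (IntermediateField.fixedField (P : Subgroup (E ≃ₐ[R] E))) =
      P.index := by
    rw [h2, ← h4, ← h5, mul_comm] at h3
    exact Nat.eq_of_mul_eq_mul_left h6 h3
  have h8 := finrank_eq_one_of_odd (R := R)
    (E := IntermediateField.fixedField (P : Subgroup (E ≃ₐ[R] E)))
    (by rw [h7]; exact Nat.not_even_iff_odd.mp (fun h => h1 (even_iff_two_dvd.mp h)))
  obtain ⟨n, hn⟩ := P.isPGroup'.exists_card_eq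
  exact ⟨n, by rw [← h5, ← h7, h8, mul_one, hn]⟩

theorem finrank_ne_two_of_forall_isSquare {F E : Type*} [Field F] [CharZero F] [Field E]
    [Algebra F E] (hsq : ∀ x : F, IsSquare x) : Module.finrank F E ≠ 2 := by
  intro h2
  have : FiniteDimensional F E := FiniteDimensional.of_finrank_pos (by omega)
  obtain ⟨x, hx⟩ := Field.exists_primitive_element F E
  have hint : IsIntegral F x := IsIntegral.of_finite F x
  have hdeg : (minpoly F x).natDegree = 2 := by
    rw [← IntermediateField.adjoin.finrank hint, hx, IntermediateField.finrank_top', h2]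
  have hirr := minpoly.irreducible hint
  obtain ⟨s, hs⟩ := hsq (discrim ((minpoly F x).coeff 2) ((minpoly F x).coeff 1)
    ((minpoly F x).coeff 0))
  have hlead : (minpoly F x).coeff 2 = 1 := by
    rw [← hdeg]; exact (minpoly.monic hint)
  obtain ⟨r, hr⟩ := exists_quadratic_eq_zero (by rw [hlead]; exact one_ne_zero) ⟨s, hs⟩
  have hroot : (minpoly F x).IsRoot r := by
    rw [IsRoot, eval_eq_sum_range, hdeg]
    simp only [Finset.sum_range_succ, Finset.sum_range_zero]
    linear_combination hr
  have : (minpoly F x).natDegree = 1 := natDegree_eq_of_degree_eq_some (degree_eq_one_of_irreducible_of_root hirr hroot)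
  omega

/-- The elements a + bi form a field F in which everything is a square, so F has no quadratic
extension. As [E : F] is a power of 2, if it were not 1 then an index-2 subgroup of the Galois group
would produce one. -/
theorem exists_eq_add_mul_sqrt_neg_one {E : Type*} [Field E] [Algebra R E]
    [FiniteDimensional R E] [IsGalois R E] (i : E) (hi : i ^ 2 = -1) (z : E) :
    ∃ a b : R, z = algebraMap R E a + algebraMap R E b * i := by
  have : CharZero E := charZero_of_injective_algebraMap (algebraMap R E).injective
  let S : Subalgebra R E := 
    { carrier := {z | ∃ a b : R, z = algebraMap R E a + algebraMap R E b * i}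
      mul_mem' := by
        rintro _ _ ⟨a, b, rfl⟩ ⟨c, d, rfl⟩
        refine ⟨a * c - b * d, a * d + b * c, ?_⟩
        simp only [map_sub, map_mul, map_add]
        linear_combination (algebraMap R E b * algebraMap R E d) * hi
      add_mem' := by
        rintro _ _ ⟨a, b, rfl⟩ ⟨c, d, rfl⟩
        exact ⟨a + c, b + d, by simp only [map_add]; ring⟩
      algebraMap_mem' := fun r => ⟨r, 0, by simp⟩ }
  let F : IntermediateField R E := S.toIntermediateField' (isField_of_isIntegral_of_isField' (R := R) (Field.toIsField R))
  have hF : ∀ x ∈ F, ∃ a b : R, x = algebraMap R E a + algebraMap R E b * i := fun x hx => hx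
  suffices h : F = ⊤ from hF z (h ▸ IntermediateField.mem_top)
  have hiF : i ∈ F := ⟨0, 1, by simp⟩
  have hsq : ∀ x : F, IsSquare x := by
    intro x
    obtain ⟨a, b, hab⟩ := hF x x.2
    obtain ⟨c, d, h1, h2⟩ := exists_complex_sqrt a b
    refine ⟨algebraMap R F c + algebraMap R F d * ⟨i, hiF⟩, Subtype.ext ?_⟩
    rw [hab, ← h1, ← h2]
    simp only [MulMemClass.coe_mul, AddMemClass.coe_add, map_sub, map_mul, map_pow, map_ofNat]
    have : ∀ r, ((algebraMap R F r : F) : E) = algebraMap R E r := fun r => rfl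
    simp only [this]
    linear_combination (-(algebraMap R E d) ^ 2) * hi
  obtain ⟨n, hn⟩ := card_galois_eq_two_pow (R := R) (E := E)
  have h4 := IsGalois.card_aut_eq_finrank R E
  have h5 := IsGalois.card_aut_eq_finrank F E
  have h6 : Module.finrank F E ∣ 2 ^ n := by
    rw [← hn, h4, ← Module.finrank_mul_finrank R F E]; exact dvd_mul_left _ _
  obtain ⟨m, -, hm⟩ := (Nat.dvd_prime_pow Nat.prime_two).mp h6
  rcases m with _ | m
  · rw [pow_zero] at hm
    exact IntermediateField.finrank_eq_one_iff_eq_top.mp hm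
  · exfalso
    have : Fact (Nat.Prime 2) := ⟨Nat.prime_two⟩
    obtain ⟨K, hK⟩ := Sylow.exists_subgroup_card_pow_prime (G := E ≃ₐ[F] E) 2 (n := m)
      (by rw [h5, hm]; exact pow_dvd_pow _ (Nat.le_succ m))
    have h7 := IntermediateField.finrank_fixedField_eq_card (F := F) (E := E) K
    have h8 := Module.finrank_mul_finrank F (IntermediateField.fixedField K) E
    rw [h7, hK, hm, pow_succ, mul_comm] at h8
    exact finrank_ne_two_of_forall_isSquare hsq
      (Nat.eq_of_mul_eq_mul_left (by positivity) h8)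

theorem irreducible_eq_quadratic {f : R[X]} (hf : Irreducible f) (hm : f.Monic)
    (hr : ∀ x, ¬ f.IsRoot x) : ∃ a b : R, b ≠ 0 ∧ f = (X - C a) ^ 2 + C b ^ 2 := by
  -- The factor X² + 1 ensures that the splitting field contains a square root of -1.
  let E := (f * (X ^ 2 + 1)).SplittingField
  have hq : (X ^ 2 + 1 : R[X]) ≠ 0 := (monic_X_pow_add_C (1 : R) two_ne_zero).ne_zero
  have hne : f * (X ^ 2 + 1) ≠ 0 := mul_ne_zero hm.ne_zero hq
  have hsplit := SplittingField.splits (f * (X ^ 2 + 1))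
  have hfs : (f.map (algebraMap R E)).Splits :=
    hsplit.of_dvd (map_ne_zero hne) (Polynomial.map_dvd _ (dvd_mul_right _ _))
  have hqs : ((X ^ 2 + 1 : R[X]).map (algebraMap R E)).Splits :=
    hsplit.of_dvd (map_ne_zero hne) (Polynomial.map_dvd _ (dvd_mul_left _ _))
  have hnorm : Normal R E := Normal.of_isSplittingField (f * (X ^ 2 + 1))
  have hgal : IsGalois R E := { }
  obtain ⟨i, hi⟩ := hqs.exists_eval_eq_zero (by
    rw [degree_map]; exact (degree_X_pow_add_C (n := 2) (by norm_num) (1 : R)).trans_ne (by norm_num))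
  obtain ⟨z, hz⟩ := hfs.exists_eval_eq_zero (by
    rw [degree_map]; exact hf.degree_pos.ne')
  have hi2 : i ^ 2 = -1 := by
    simp only [Polynomial.map_add, Polynomial.map_pow, map_X, Polynomial.map_one, eval_add,
      eval_pow, eval_X, eval_one] at hi
    exact eq_neg_of_add_eq_zero_left hi
  obtain ⟨a, b, hab⟩ := exists_eq_add_mul_sqrt_neg_one (R := R) i hi2 z
  rw [eval_map_algebraMap] at hz
  have hmin : f = minpoly R z := minpoly.eq_of_irreducible_of_monic hf hz hm
  have hz2 : aeval z ((X - C a) ^ 2 + C b ^ 2 : R[X]) = 0 := by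
    simp only [map_add, map_pow, map_sub, aeval_X, aeval_C]
    rw [hab]; linear_combination (algebraMap R E b) ^ 2 * hi2
  have hdvd : f ∣ (X - C a) ^ 2 + C b ^ 2 := hmin ▸ minpoly.dvd R z hz2
  have hm2 : ((X - C a) ^ 2 + C b ^ 2 : R[X]).Monic := by
    rw [← C_pow]; exact ((monic_X_sub_C a).pow 2).add_of_left (by
      rw [degree_pow, degree_X_sub_C]; exact degree_C_le.trans_lt (by norm_num))
  have hd2 : ((X - C a) ^ 2 + C b ^ 2 : R[X]).natDegree = 2 := by
    rw [← C_pow, natDegree_add_C, natDegree_pow, natDegree_X_sub_C]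
  refine ⟨a, b, ?_, ?_⟩
  · rintro rfl
    refine hr a ?_
    have h0 : aeval z f = algebraMap R E (f.eval a) := by
      rw [hab, map_zero, zero_mul, add_zero, aeval_algebraMap_apply, coe_aeval_eq_eval]
    rw [h0] at hz
    exact (FaithfulSMul.algebraMap_eq_zero_iff R E).mp hz
  · have hdeg : 2 ≤ f.natDegree := by
      have h1 := hf.natDegree_pos
      by_contra hlt
      have h2 : f.natDegree = 1 := by omega
      have := hm.eq_X_add_C h2
      exact hr (-f.coeff 0) (by rw [this]; simp)
    exact (eq_of_monic_of_dvd_of_natDegree_le hm hm2 hdvd (by omega)).symm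

/-- The intermediate value property, factor by factor: a linear factor with its root outside [a, b]
keeps its sign there, and a rootless irreducible factor is a sum of squares with a nonzero constant
term. -/
theorem eval_pos_or_neg_of_forall_ne {f : R[X]} {a b : R} (hab : a ≤ b)
    (h : ∀ x, a ≤ x → x ≤ b → f.eval x ≠ 0) : 0 < f.eval a * f.eval b := by
  have hf : f ≠ 0 := by rintro rfl; exact h a le_rfl hab eval_zero
  induction hn : f.natDegree using Nat.strong_induction_on generalizing f with
  | _ n ih =>
    by_cases hu : IsUnit f
    · obtain ⟨c, hc, rfl⟩ := isUnit_iff.mp hu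
      rw [eval_C, eval_C]; exact mul_self_pos.mpr hc.ne_zero
    obtain ⟨g, hgm, hg, q, rfl⟩ := exists_monic_irreducible_factor f hu
    have hq : q ≠ 0 := right_ne_zero_of_mul hf
    have hdeg := natDegree_mul hg.ne_zero hq
    have hgd := hg.natDegree_pos
    have h1 := ih q.natDegree (by omega) (f := q)
      (fun x h1 h2 h3 => h x h1 h2 (by rw [eval_mul, h3, mul_zero])) hq rfl
    suffices h2 : 0 < g.eval a * g.eval b by
      rw [eval_mul, eval_mul]; nlinarith [mul_pos h1 h2]
    by_cases hr : ∃ x, g.IsRoot x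
    · obtain ⟨x, hx⟩ := hr
      have h3 := natDegree_eq_of_degree_eq_some (degree_eq_one_of_irreducible_of_root hg hx)
      have h4 := hgm.eq_X_add_C h3
      have hx' : g.coeff 0 = -x := by
        rw [h4, IsRoot, eval_add, eval_X, eval_C] at hx; linear_combination hx
      rw [h4, hx']
      simp only [eval_add, eval_X, eval_C]
      rcases lt_or_ge x a with hxa | hxa
      · exact mul_pos (by linarith) (by linarith)
      rcases lt_or_ge b x with hxb | hxb
      · exact mul_pos_of_neg_of_neg (by linarith) (by linarith)
      · exact absurd (by rw [eval_mul, hx.eq_zero, zero_mul]) (h x hxa hxb)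
    · obtain ⟨c, d, hd, rfl⟩ := irreducible_eq_quadratic hg hgm (not_exists.mp hr)
      have hd2 : 0 < d ^ 2 := by positivity
      simp only [eval_add, eval_pow, eval_sub, eval_X, eval_C]
      positivity

theorem exists_root_of_eval_mul_nonpos {f : R[X]} {a b : R} (hab : a ≤ b)
    (h : f.eval a * f.eval b ≤ 0) : ∃ x, a ≤ x ∧ x ≤ b ∧ f.eval x = 0 := by
  by_contra! hc
  exact (eval_pos_or_neg_of_forall_ne hab hc).not_ge h

theorem exists_derivative_root {f : R[X]} {a b : R} (hab : a < b) (ha : f.eval a = 0)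
    (hb : f.eval b = 0) : ∃ x, a < x ∧ x < b ∧ (derivative f).eval x = 0 := by
  by_cases hf : f = 0
  · exact ⟨(a + b) / 2, by linarith, by linarith, by simp [hf]⟩
  -- Rolle is proved on the interval from a to the next root c, where the cofactor q of the powers
  -- of X - a and X - c has no zero.
  let T := f.roots.toFinset.filter (fun x => a < x)
  have hbT : b ∈ T := by simp [T, hf, hb, hab]
  have hT : T.Nonempty := ⟨b, hbT⟩
  set c := T.min' hT with hc
  have hcT : c ∈ T := T.min'_mem hT
  have hcb : c ≤ b := T.min'_le b hbT
  simp only [T, Finset.mem_filter, Multiset.mem_toFinset, mem_roots hf, IsRoot] at hcT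
  obtain ⟨hc0, hac⟩ := hcT
  have hno : ∀ x, a < x → x < c → f.eval x ≠ 0 := by
    intro x h1 h2 h3
    have : x ∈ T := by simp [T, hf, h1, h3]
    exact absurd (T.min'_le x this) (not_le.mpr h2)
  obtain ⟨g, hg, hga⟩ := exists_eq_pow_rootMultiplicity_mul_and_not_dvd f hf a
  set m := rootMultiplicity a f
  have hm : 0 < m := (rootMultiplicity_pos hf).mpr ha
  have hg0 : g ≠ 0 := by rintro rfl; exact hga (dvd_zero _)
  obtain ⟨q, hq, hqc⟩ := exists_eq_pow_rootMultiplicity_mul_and_not_dvd g hg0 c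
  set n := rootMultiplicity c g
  have hn : 0 < n := by
    refine (rootMultiplicity_pos hg0).mpr ?_
    rw [hg, eval_mul, eval_pow, eval_sub, eval_X, eval_C] at hc0
    exact (mul_eq_zero.mp hc0).resolve_left (pow_ne_zero _ (sub_ne_zero.mpr hac.ne'))
  obtain ⟨m, hm'⟩ : ∃ m', m = m' + 1 := ⟨m - 1, by omega⟩
  obtain ⟨n, hn'⟩ : ∃ n', n = n' + 1 := ⟨n - 1, by omega⟩
  rw [hm'] at hg
  rw [hn'] at hq
  have hfq : f = (X - C a) ^ (m + 1) * ((X - C c) ^ (n + 1) * q) := by rw [hg, hq]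
  -- D is what remains of f' after removing the powers of X - a and X - c. At a and c only one of
  -- its terms survives, and the factors a - c and c - a make the two values opposite in sign.
  let D : R[X] := C (m + 1 : R) * (X - C c) * q + C (n + 1 : R) * (X - C a) * q +
    (X - C a) * (X - C c) * derivative q
  have hD : derivative f = (X - C a) ^ m * (X - C c) ^ n * D := by
    rw [hfq]
    simp only [D, derivative_mul, derivative_X_sub_C_pow, C_add, C_1, map_natCast,
      Nat.add_sub_cancel, Nat.cast_add, Nat.cast_one]
    ring
  have hqa : q.eval a ≠ 0 := by
    intro h; exact hga (dvd_iff_isRoot.mpr (by rw [hq, IsRoot, eval_mul, h, mul_zero]))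
  have hqpos : 0 < q.eval a * q.eval c := by
    refine eval_pos_or_neg_of_forall_ne hac.le fun x h1 h2 h3 => ?_
    rcases h1.eq_or_lt with rfl | h1
    · exact hqa h3
    rcases h2.eq_or_lt with rfl | h2
    · exact hqc (dvd_iff_isRoot.mpr h3)
    exact hno x h1 h2 (by rw [hfq, eval_mul, eval_mul, h3, mul_zero, mul_zero])
  have hDa : D.eval a = (m + 1) * (a - c) * q.eval a := by
    simp [D]
  have hDc : D.eval c = (n + 1) * (c - a) * q.eval c := by
    simp [D]
  have hneg : D.eval a * D.eval c < 0 := by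
    rw [hDa, hDc]
    have h1 : 0 < (m + 1 : R) * (n + 1) * (c - a) ^ 2 * (q.eval a * q.eval c) := by
      have : 0 < c - a := sub_pos.mpr hac
      positivity
    linarith
  obtain ⟨x, h1, h2, h3⟩ := exists_root_of_eval_mul_nonpos hac.le hneg.le
  have hxa : x ≠ a := by rintro rfl; rw [h3, zero_mul] at hneg; exact lt_irrefl _ hneg
  have hxc : x ≠ c := by rintro rfl; rw [h3, mul_zero] at hneg; exact lt_irrefl _ hneg
  exact ⟨x, lt_of_le_of_ne h1 hxa.symm, (lt_of_le_of_ne h2 hxc).trans_le hcb,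
    by rw [hD, eval_mul, h3, mul_zero]⟩

theorem eval_lt_eval_of_derivative_pos {f : R[X]} {a b : R} (hab : a < b)
    (h : ∀ x, a < x → x < b → 0 < (derivative f).eval x) : f.eval a < f.eval b := by
  have hba : 0 < b - a := sub_pos.mpr hab
  let s := (f.eval b - f.eval a) / (b - a)
  have hs : s * (b - a) = f.eval b - f.eval a := div_mul_cancel₀ _ hba.ne'
  obtain ⟨x, h1, h2, h3⟩ := exists_derivative_root (f := f - C (f.eval a) - C s * (X - C a)) hab
    (by simp) (by simp only [eval_sub, eval_mul, eval_C, eval_X]; linear_combination -hs)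
  have h4 : (derivative f).eval x = s := by
    simp only [derivative_sub, derivative_C, derivative_mul, derivative_X, eval_sub, eval_add,
      eval_mul, eval_C, eval_zero, eval_one] at h3
    linear_combination h3
  have h5 := h x h1 h2
  rw [h4] at h5
  nlinarith [mul_pos h5 hba]

end RealClosed

/-! ### Traces on S[X]/(P): base change and expression through the roots. -/

section TraceFormula

/-- Diagonal entries of multiplication in the power basis; division by a monic polynomial commutes
with ring homomorphisms, so this formula makes the trace specialize. -/
theorem trace_mk_eq_sum_coeff {S : Type*} [CommRing S] {P : S[X]} (hP : P.Monic) (B : S[X]) :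
    Algebra.trace S (AdjoinRoot P) (AdjoinRoot.mk P B) =
      ∑ i ∈ Finset.range P.natDegree, ((B * X ^ i) %ₘ P).coeff i := by
  rw [Algebra.trace_eq_matrix_trace (AdjoinRoot.powerBasis' hP).basis, Matrix.trace,
    ← Fin.sum_univ_eq_sum_range (fun i => ((B * X ^ i) %ₘ P).coeff i)]
  refine Finset.sum_congr rfl fun i _ => ?_
  rw [Matrix.diag_apply, Algebra.leftMulMatrix_eq_repr_mul, PowerBasis.basis_eq_pow,
    AdjoinRoot.powerBasis'_gen, AdjoinRoot.root, ← map_pow, ← map_mul,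
    ← AdjoinRoot.modByMonicHom_mk hP]
  exact AdjoinRoot.powerBasisAux'_repr_apply_to_fun hP _ i

theorem map_trace_mk {S T : Type*} [CommRing S] [CommRing T] [Nontrivial T] (φ : S →+* T)
    {P : S[X]} (hP : P.Monic) (B : S[X]) :
    φ (Algebra.trace S (AdjoinRoot P) (AdjoinRoot.mk P B)) =
      Algebra.trace T (AdjoinRoot (P.map φ)) (AdjoinRoot.mk (P.map φ) (B.map φ)) := by
  rw [trace_mk_eq_sum_coeff hP, trace_mk_eq_sum_coeff (hP.map φ), map_sum, hP.natDegree_map]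
  refine Finset.sum_congr rfl fun i _ => ?_
  rw [← coeff_map, map_modByMonic φ hP, Polynomial.map_mul, Polynomial.map_pow, map_X]

variable {T : Type*} [Field T]

/-- Identify T × T[X]/(G) with T[X]/((X - a)G) by (c, Q) ↦ c + (X - a)Q. Writing B = B(a) + (X -
a)q, multiplication by B becomes block triangular, with diagonal blocks B(a) and multiplication by
B; the repeated roots need no separate treatment. -/
theorem trace_mk_X_sub_C_mul {G : T[X]} (hG : G.Monic) (a : T) (B : T[X]) :
    Algebra.trace T (AdjoinRoot ((X - C a) * G)) (AdjoinRoot.mk _ B) =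
      B.eval a + Algebra.trace T (AdjoinRoot G) (AdjoinRoot.mk G B) := by
  have hF : ((X - C a) * G).Monic := (monic_X_sub_C a).mul hG
  have : Module.Finite T (AdjoinRoot G) := hG.finite_adjoinRoot
  have : Module.Finite T (AdjoinRoot ((X - C a) * G)) := hF.finite_adjoinRoot
  let Fm : T[X] := (X - C a) * G
  let f : T × AdjoinRoot G →ₗ[T] AdjoinRoot Fm :=
    (AdjoinRoot.mkₐ Fm).toLinearMap ∘ₗ
      ((Algebra.linearMap T T[X]).coprod
        ((LinearMap.mulLeft T (X - C a)) ∘ₗ AdjoinRoot.modByMonicHom hG))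
  have hf : ∀ c Q, f (c, AdjoinRoot.mk G Q) = AdjoinRoot.mk Fm (C c + (X - C a) * Q) := by
    intro c Q
    have h1 : f (c, AdjoinRoot.mk G Q) = AdjoinRoot.mk Fm (C c + (X - C a) * (Q %ₘ G)) := by
      simp [f, AdjoinRoot.modByMonicHom_mk, Algebra.linearMap_apply]
    rw [h1, AdjoinRoot.mk_eq_mk]
    refine ⟨- (Q /ₘ G), ?_⟩
    have := modByMonic_add_div Q G
    linear_combination (X - C a) * this
  have hsurj : Function.Surjective f := by
    intro x
    obtain ⟨Q, rfl⟩ := AdjoinRoot.mk_surjective x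
    obtain ⟨q, hq⟩ : X - C a ∣ Q - C (Q.eval a) := X_sub_C_dvd_sub_C_eval
    exact ⟨(Q.eval a, AdjoinRoot.mk G q), by rw [hf, ← hq]; congr 1; ring⟩
  have hrank : Module.finrank T (T × AdjoinRoot G) = Module.finrank T (AdjoinRoot Fm) := by
    rw [Module.finrank_prod, Module.finrank_self, (AdjoinRoot.powerBasis' hG).finrank,
      (AdjoinRoot.powerBasis' hF).finrank, AdjoinRoot.powerBasis'_dim, AdjoinRoot.powerBasis'_dim,
      (monic_X_sub_C a).natDegree_mul hG, natDegree_X_sub_C]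
  have hinj : Function.Injective f :=
    (LinearMap.injective_iff_surjective_of_finrank_eq_finrank hrank).mpr hsurj
  let e : (T × AdjoinRoot G) ≃ₗ[T] AdjoinRoot Fm := LinearEquiv.ofBijective f ⟨hinj, hsurj⟩
  obtain ⟨q, hq⟩ : X - C a ∣ B - C (B.eval a) := X_sub_C_dvd_sub_C_eval
  let N : Module.End T (T × AdjoinRoot G) :=
    LinearMap.prodMap (B.eval a • LinearMap.id) (Algebra.lmul T _ (AdjoinRoot.mk G B)) +
      LinearMap.inr T T _ ∘ₗ ((LinearMap.toSpanSingleton T _ (AdjoinRoot.mk G q)) ∘ₗ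
        LinearMap.fst T T (AdjoinRoot G))
  have hconj : e.conj N = Algebra.lmul T _ (AdjoinRoot.mk Fm B) := by
    refine LinearMap.ext fun x => ?_
    obtain ⟨⟨c, y⟩, rfl⟩ := e.surjective x
    obtain ⟨Q, rfl⟩ := AdjoinRoot.mk_surjective y
    rw [LinearEquiv.conj_apply_apply, LinearEquiv.symm_apply_apply]
    have hN : N (c, AdjoinRoot.mk G Q) =
        (B.eval a * c, AdjoinRoot.mk G (B * Q + C c * q)) := by
      simp [N, Algebra.smul_def, AdjoinRoot.algebraMap_eq]
    change f _ = AdjoinRoot.mk Fm B * f _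
    rw [hN, hf, hf, ← map_mul]
    congr 1
    rw [C_mul]
    linear_combination - C c * hq
  rw [Algebra.trace_apply]
  change LinearMap.trace T _ (Algebra.lmul T _ (AdjoinRoot.mk Fm B)) = _
  rw [← hconj, LinearMap.trace_conj', map_add, LinearMap.trace_prodMap', LinearMap.trace_comp_comm',
    Algebra.trace_apply]
  have h0 : ((LinearMap.toSpanSingleton T _ (AdjoinRoot.mk G q)) ∘ₗ
        LinearMap.fst T T (AdjoinRoot G)) ∘ₗ LinearMap.inr T T _ = 0 := by
    ext; simp
  rw [h0, map_zero, add_zero]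
  simp

theorem trace_mk_multiset_prod (s : Multiset T) (B : T[X]) :
    Algebra.trace T (AdjoinRoot (s.map fun a => X - C a).prod) (AdjoinRoot.mk _ B) =
      (s.map fun a => B.eval a).sum := by
  induction s using Multiset.induction_on with
  | empty =>
    rw [Multiset.map_zero, Multiset.prod_zero, Multiset.map_zero, Multiset.sum_zero,
      trace_mk_eq_sum_coeff monic_one]
    simp
  | cons a s ih =>
    rw [Multiset.map_cons, Multiset.prod_cons, Multiset.map_cons, Multiset.sum_cons, ← ih]
    exact trace_mk_X_sub_C_mul (monic_multiset_prod_of_monic _ _ fun a _ => monic_X_sub_C a) a B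

theorem trace_mk_prod_pow {ι : Type*} [Fintype ι] (ρ : ι → T) (m : ι → ℕ) {F : T[X]}
    (hF : F = ∏ i, (X - C (ρ i)) ^ m i) (B : T[X]) :
    Algebra.trace T (AdjoinRoot F) (AdjoinRoot.mk F B) = ∑ i, m i * B.eval (ρ i) := by
  have h : F = ((∑ i, m i • ({ρ i} : Multiset T)).map fun a => X - C a).prod := by
    rw [hF, ← Multiset.coe_mapAddMonoidHom, map_sum, Multiset.prod_sum]
    simp [Multiset.map_nsmul, Multiset.prod_nsmul]
  subst h
  rw [trace_mk_multiset_prod, ← Multiset.coe_mapAddMonoidHom, map_sum, Multiset.sum_sum]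
  simp [Multiset.map_nsmul, Multiset.sum_nsmul]

end TraceFormula

/-! ### Hankel minors across a gap of vanishing minors. -/

section Hankel

variable {R : Type*} [Field R]

/-- The leading principal minor of size `n` of the Hankel matrix of the functional `L`. -/
noncomputable def hankelMinor (L : R[X] →ₗ[R] R) (n : ℕ) : R :=
  (Matrix.of fun i j : Fin n => L (X ^ ((i : ℕ) + (j : ℕ)))).det

theorem apply_mul_eq_zero_of_degree_lt {L : R[X] →ₗ[R] R} {q : R[X]} {n : ℕ}
    (h : ∀ j < n, L (q * X ^ j) = 0) {f : R[X]} (hf : f.degree < n) : L (q * f) = 0 := by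
  by_cases hf0 : f = 0
  · rw [hf0, mul_zero, map_zero]
  rw [f.as_sum_range_C_mul_X_pow' ((natDegree_lt_iff_degree_lt hf0).mpr hf), Finset.mul_sum,
    map_sum]
  refine Finset.sum_eq_zero fun j hj => ?_
  rw [mul_left_comm, ← smul_eq_C_mul, map_smul, h j (Finset.mem_range.mp hj), smul_zero]

theorem exists_orthogonal_of_hankelMinor_ne_zero (L : R[X] →ₗ[R] R) {h : ℕ}
    (hD : hankelMinor L h ≠ 0) :
    ∃ q : R[X], q.Monic ∧ q.natDegree = h ∧ ∀ j < h, L (q * X ^ j) = 0 := by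
  let H : Matrix (Fin h) (Fin h) R := Matrix.of fun i j : Fin h => L (X ^ ((i : ℕ) + (j : ℕ)))
  have hH : IsUnit H.det := isUnit_iff_ne_zero.mpr hD
  let v : Fin h → R := H⁻¹.mulVec fun i => -L (X ^ ((i : ℕ) + h))
  have hv : H.mulVec v = fun i : Fin h => -L (X ^ ((i : ℕ) + h)) := by
    rw [Matrix.mulVec_mulVec, Matrix.mul_nonsing_inv _ hH, Matrix.one_mulVec]
  have hdeg : (∑ i : Fin h, C (v i) * X ^ (i : ℕ)).degree < (h : WithBot ℕ) := degree_sum_fin_lt v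
  refine ⟨X ^ h + ∑ i : Fin h, C (v i) * X ^ (i : ℕ), monic_X_pow_add hdeg, ?_, fun j hj => ?_⟩
  · exact natDegree_eq_of_degree_eq_some (by rw [degree_add_eq_left_of_degree_lt] <;> simp [hdeg])
  · have := congr_fun hv ⟨j, hj⟩
    simp only [Matrix.mulVec, dotProduct, H, Matrix.of_apply] at this
    rw [add_mul, ← pow_add, map_add, Finset.sum_mul, map_sum, add_comm h j, add_comm,
      ← eq_neg_iff_add_eq_zero, ← this]
    refine Finset.sum_congr rfl fun i _ => ?_
    rw [mul_assoc, ← pow_add, ← smul_eq_C_mul, map_smul, smul_eq_mul, mul_comm, add_comm (i : ℕ)]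

/-- The sign of the permutation reversing `k` indices, as an element of `R`. -/
def reverseSign (R : Type*) [Ring R] (k : ℕ) : R :=
  ((Equiv.Perm.sign (Fin.revPerm : Equiv.Perm (Fin k)) : ℤ) : R)

theorem det_of_antitriangular {k : ℕ} (D : Matrix (Fin k) (Fin k) R) (c : R)
    (h0 : ∀ i j : Fin k, (i : ℕ) + j + 1 < k → D i j = 0)
    (h1 : ∀ i j : Fin k, (i : ℕ) + j + 1 = k → D i j = c) : D.det = reverseSign R k * c ^ k := by
  have hrev : (D.submatrix id (Fin.revPerm : Equiv.Perm (Fin k))).det = c ^ k := by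
    rw [Matrix.det_of_isLowerTriangular]
    · rw [Finset.prod_congr rfl (g := fun _ => c)]
      · simp
      · intro i _
        refine h1 _ _ ?_
        simp only [id, Fin.revPerm_apply, Fin.val_rev]; omega
    · intro i j hij
      refine h0 _ _ ?_
      have : (i : ℕ) < j := hij
      simp only [id, Fin.revPerm_apply, Fin.val_rev]; omega
  rw [Matrix.det_permute'] at hrev
  rw [← hrev, reverseSign, ← mul_assoc, ← Int.cast_mul, ← Units.val_mul, Int.units_mul_self]
  simp

/-- In the basis 1, …, X^(h-1), q, qX, …, qX^(k-1), which is unitriangular over the monomials, the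
Gram matrix is block diagonal. The second block vanishes above its antidiagonal, where it is
constant. -/
theorem hankelMinor_add (L : R[X] →ₗ[R] R) {h k : ℕ} {q : R[X]} (hq : q.Monic)
    (hqd : q.natDegree = h) (hL : ∀ j, j + 1 < h + k → L (q * X ^ j) = 0) :
    hankelMinor L (h + k) =
      hankelMinor L h * (reverseSign R k * L (q * X ^ (h + k - 1)) ^ k) := by
  let e : ℕ → R[X] := fun i => if i < h then X ^ i else q * X ^ (i - h)
  have he : ∀ i, (e i).Monic ∧ (e i).natDegree = i := by
    intro i
    by_cases hi : i < h
    · simp only [e, if_pos hi]; exact ⟨monic_X_pow i, natDegree_X_pow i⟩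
    · simp only [e, if_neg hi]
      refine ⟨hq.mul (monic_X_pow _), ?_⟩
      rw [hq.natDegree_mul (monic_X_pow _), natDegree_X_pow]; omega
  let H : Matrix (Fin (h + k)) (Fin (h + k)) R :=
    Matrix.of fun i j => L (X ^ ((i : ℕ) + (j : ℕ)))
  let U : Matrix (Fin (h + k)) (Fin (h + k)) R := Matrix.of fun i j => (e j).coeff i
  have hU : U.det = 1 := Matrix.det_matrixOfPolynomials (fun i => e i) (fun i => (he i).2)
    (fun i => (he i).1)
  have hG : U.transpose * H * U = Matrix.of fun i j : Fin (h + k) => L (e i * e j) := by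
    ext i j
    have hexp : ∀ i : Fin (h + k), e i = ∑ a : Fin (h + k), C ((e i).coeff a) * X ^ (a : ℕ) := by
      intro i
      conv_lhs => rw [(e i).as_sum_range_C_mul_X_pow' (n := h + k) (by rw [(he i).2]; exact i.2)]
      exact (Fin.sum_univ_eq_sum_range (fun a => C ((e i).coeff a) * X ^ a) (h + k)).symm
    rw [Matrix.of_apply, hexp i, hexp j, Finset.sum_mul_sum, Finset.sum_comm, map_sum,
      Matrix.mul_apply]
    refine Finset.sum_congr rfl fun b _ => ?_
    rw [Matrix.mul_apply, Finset.sum_mul, map_sum]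
    refine Finset.sum_congr rfl fun a _ => ?_
    have : C ((e i).coeff a) * X ^ (a : ℕ) * (C ((e j).coeff b) * X ^ (b : ℕ)) =
        ((e i).coeff a * (e j).coeff b) • X ^ ((a : ℕ) + b) := by
      rw [smul_eq_C_mul, C_mul, pow_add]; ring
    rw [this, map_smul, smul_eq_mul]
    simp only [U, H, Matrix.transpose_apply, Matrix.of_apply]
    ring
  have hdet : hankelMinor L (h + k) = (Matrix.of fun i j : Fin (h + k) => L (e i * e j)).det := by
    rw [← hG, Matrix.det_mul, Matrix.det_mul, Matrix.det_transpose, hU, one_mul, mul_one]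
    rfl
  have hsmall : ∀ f : R[X], f.degree < ((h + k - 1 : ℕ) : WithBot ℕ) → L (q * f) = 0 :=
    fun f hf => apply_mul_eq_zero_of_degree_lt (fun j hj => hL j (by omega)) hf
  rw [hdet, ← Matrix.det_submatrix_equiv_self finSumFinEquiv]
  have hblock : (Matrix.of fun i j : Fin (h + k) => L (e i * e j)).submatrix
      finSumFinEquiv finSumFinEquiv =
      Matrix.fromBlocks (Matrix.of fun i j : Fin h => L (X ^ ((i : ℕ) + (j : ℕ)))) 0 0
        (Matrix.of fun i j : Fin k => L (q * (X ^ ((i : ℕ) + j) * q))) := by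
    ext i j
    rcases i with i | i <;> rcases j with j | j <;>
      simp only [Matrix.submatrix_apply, Matrix.of_apply, finSumFinEquiv_apply_left,
        finSumFinEquiv_apply_right, Fin.val_castAdd, Fin.val_natAdd, e, i.2, j.2, if_true,
        Matrix.fromBlocks_apply₁₁, Matrix.fromBlocks_apply₁₂, Matrix.fromBlocks_apply₂₁,
        Matrix.fromBlocks_apply₂₂, Matrix.zero_apply, Nat.not_lt.mpr (Nat.le_add_right h _),
        if_false, Nat.add_sub_cancel_left]
    · rw [pow_add]
    · rw [mul_left_comm, ← pow_add]; exact hL _ (by omega)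
    · rw [mul_assoc, ← pow_add]; exact hL _ (by omega)
    · congr 1; rw [pow_add]; ring
  rw [hblock, Matrix.det_fromBlocks_zero₂₁]
  congr 1
  refine det_of_antitriangular _ _ ?_ ?_
  · intro i j hij
    rw [Matrix.of_apply]
    refine hsmall _ ?_
    rw [degree_mul, degree_X_pow, degree_eq_natDegree hq.ne_zero, hqd]
    norm_cast; omega
  · intro i j hij
    rw [Matrix.of_apply]
    have hlow : (q - X ^ h).degree < (h : WithBot ℕ) := by
      have := degree_sub_lt_left (p := q) (q := X ^ h)
        (by rw [degree_X_pow, degree_eq_natDegree hq.ne_zero, hqd]) hq.ne_zero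
        (by rw [hq.leadingCoeff, (monic_X_pow h).leadingCoeff])
      rwa [degree_eq_natDegree hq.ne_zero, hqd] at this
    have : q * (X ^ ((i : ℕ) + j) * q) =
        -- On the antidiagonal only the leading term X^h of the second factor q counts; the rest has
        -- degree too small for L(q · ) to see.
        q * X ^ (h + k - 1) + q * (X ^ ((i : ℕ) + j) * (q - X ^ h)) := by
      have : h + k - 1 = (i : ℕ) + j + h := by omega
      rw [this, pow_add _ _ h]; ring
    rw [this, map_add, hsmall (X ^ ((i : ℕ) + j) * (q - X ^ h)) ?_, add_zero]
    by_cases h0 : q - X ^ h = 0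
    · rw [h0, mul_zero, degree_zero]; exact WithBot.bot_lt_coe _
    · rw [degree_eq_natDegree h0] at hlow
      rw [degree_mul, degree_X_pow, degree_eq_natDegree h0]
      norm_cast at hlow ⊢; omega

theorem reverseSign_ne_zero (k : ℕ) : reverseSign R k ≠ 0 := by
  rw [reverseSign]
  rcases Int.units_eq_one_or (Equiv.Perm.sign (Fin.revPerm : Equiv.Perm (Fin k))) with h | h <;>
    rw [h] <;> simp

theorem hankelMinor_zero (L : R[X] →ₗ[R] R) : hankelMinor L 0 = 1 := Matrix.det_fin_zero

/-- Inductively, if L(qX^i) = 0 for i < h + l, the minor of size h + l + 1 is a nonzero multiple of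
L(qX^(h+l))^(l+1); its vanishing extends the orthogonality by one step. -/
theorem apply_orthogonal_eq_zero_of_gap (L : R[X] →ₗ[R] R) {h k : ℕ} {q : R[X]} (hq : q.Monic)
    (hqd : q.natDegree = h) (hL : ∀ j < h, L (q * X ^ j) = 0) (hD : hankelMinor L h ≠ 0)
    (hgap : ∀ j, h < j → j < h + k → hankelMinor L j = 0) :
    ∀ j, j + 1 < h + k → L (q * X ^ j) = 0 := by
  intro j
  induction j using Nat.strong_induction_on with
  | _ j ih =>
    intro hj
    by_cases hjh : j < h
    · exact hL j hjh
    obtain ⟨l, rfl⟩ : ∃ l, j = h + l := ⟨j - h, by omega⟩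
    have := hankelMinor_add L (k := l + 1) hq hqd (fun i hi => ih i (by omega) (by omega))
    rw [hgap _ (by omega) (by omega)] at this
    have h2 := (mul_eq_zero.mp this.symm).resolve_left hD
    have h3 := (mul_eq_zero.mp h2).resolve_left (reverseSign_ne_zero _)
    exact pow_eq_zero_iff (Nat.succ_ne_zero l) |>.mp h3

end Hankel

/-! ### Signs of Hankel minors determine the signature. -/

section Inertia

variable {R : Type*} [Field R] [LinearOrder R]

/-- The form `f ↦ L (f ^ 2)` is nonnegative on some `z`-dimensional space of polynomials of
degree `< n`. -/
def HasNonnegSubspace (L : R[X] →ₗ[R] R) (n z : ℕ) : Prop :=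
  ∃ Z : Submodule R R[X], Z ≤ degreeLT R n ∧ Module.finrank R Z = z ∧ ∀ f ∈ Z, 0 ≤ L (f * f)

theorem HasNonnegSubspace.zero (L : R[X] →ₗ[R] R) : HasNonnegSubspace L 0 0 :=
  ⟨⊥, bot_le, finrank_bot R _, fun f hf => by rw [(Submodule.mem_bot R).mp hf]; simp⟩

variable [IsStrictOrderedRing R]

/-- Adjoin the multiples qg with deg g < m, which are orthogonal to the old space. If 2m ≤ k they
are isotropic. If 2m = k + 1, only the top coefficient c of g survives, with value c² L(qX^(h+k-1)).
-/
theorem HasNonnegSubspace.add {L : R[X] →ₗ[R] R} {h k z m : ℕ} (hZ : HasNonnegSubspace L h z)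
    {q : R[X]} (hq : q.Monic) (hqd : q.natDegree = h)
    (hL : ∀ j, j + 1 < h + k → L (q * X ^ j) = 0)
    (hm : 2 * m ≤ k ∨ (2 * m = k + 1 ∧ 0 ≤ L (q * X ^ (h + k - 1)))) :
    HasNonnegSubspace L (h + k) (z + m) := by
  obtain ⟨Z, hZd, hZr, hZL⟩ := hZ
  have hsmall : ∀ f : R[X], f.degree < ((h + k - 1 : ℕ) : WithBot ℕ) → L (q * f) = 0 :=
    fun f hf => apply_mul_eq_zero_of_degree_lt (fun j hj => hL j (by omega)) hf
  let W : Submodule R R[X] := (degreeLT R m).map (LinearMap.mulLeft R q)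
  have hqdeg : q.degree = (h : WithBot ℕ) := by rw [degree_eq_natDegree hq.ne_zero, hqd]
  have hinj : Function.Injective (LinearMap.mulLeft R q) := mul_right_injective₀ hq.ne_zero
  have hfin : ∀ (n : ℕ), Module.Finite R (degreeLT R n) := fun n =>
    Module.Finite.equiv (degreeLTEquiv R n).symm
  have : Module.Finite R Z := Submodule.finiteDimensional_of_le hZd
  have hWr : Module.finrank R W = m := by
    rw [LinearEquiv.finrank_eq (Submodule.equivMapOfInjective _ hinj (degreeLT R m)).symm,
      (degreeLTEquiv R m).finrank_eq, Module.finrank_fin_fun]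
  have hdisj : Z ⊓ W = ⊥ := by
    rw [eq_bot_iff]
    rintro f ⟨hf, g, -, rfl⟩
    have h1 := mem_degreeLT.mp (hZd hf)
    rw [LinearMap.mulLeft_apply] at h1 ⊢
    by_cases hg : g = 0
    · simp [hg]
    · rw [degree_mul, hqdeg, degree_eq_natDegree hg] at h1
      norm_cast at h1; omega
  refine ⟨Z ⊔ W, ?_, ?_, ?_⟩
  · refine sup_le (hZd.trans (degreeLT_mono (by omega))) ?_
    rintro _ ⟨g, hg, rfl⟩
    have hg := mem_degreeLT.mp hg
    rw [LinearMap.mulLeft_apply, mem_degreeLT]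
    by_cases hg0 : g = 0
    · rw [hg0, mul_zero, degree_zero]; exact WithBot.bot_lt_coe _
    · rw [degree_eq_natDegree hg0] at hg
      rw [degree_mul, hqdeg, degree_eq_natDegree hg0]
      norm_cast at hg ⊢; omega
  · have : Module.Finite R W := Module.Finite.map _ _
    have := Submodule.finrank_sup_add_finrank_inf_eq Z W
    rw [hdisj, finrank_bot, hZr, hWr, add_zero] at this
    exact this
  · intro f hf
    obtain ⟨a, ha, _, ⟨g, hg, rfl⟩, rfl⟩ := Submodule.mem_sup.mp hf
    have hg := mem_degreeLT.mp hg
    have had := mem_degreeLT.mp (hZd ha)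
    rw [LinearMap.mulLeft_apply]
    by_cases hg0 : g = 0
    · rw [hg0, mul_zero, add_zero]; exact hZL a ha
    have hgn : g.natDegree < m := (natDegree_lt_iff_degree_lt hg0).mpr hg
    have hcross : L (q * (g * a)) = 0 := by
      refine hsmall _ ?_
      by_cases ha0 : a = 0
      · rw [ha0, mul_zero, degree_zero]; exact WithBot.bot_lt_coe _
      · have := (natDegree_lt_iff_degree_lt ha0).mpr had
        rw [degree_mul, degree_eq_natDegree hg0, degree_eq_natDegree ha0]
        norm_cast; omega
    have hexp : (a + q * g) * (a + q * g) =
        a * a + (2 : R) • (q * (g * a)) + q * (q * g ^ 2) := by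
      rw [smul_eq_C_mul, C_ofNat]; ring
    rw [hexp, map_add, map_add, map_smul, hcross, smul_zero, add_zero]
    refine add_nonneg (hZL a ha) ?_
    by_cases hdeg : h + 2 * g.natDegree < h + k - 1
    · refine (hsmall _ ?_).ge
      rw [degree_mul, sq, degree_mul, hqdeg, degree_eq_natDegree hg0]
      norm_cast; omega
    · rcases hm with hm | ⟨hm, hc⟩
      · omega
      have hgd : h + 2 * g.natDegree = h + k - 1 := by omega
      let c := g.leadingCoeff
      have hlow : (q * g ^ 2 - C (c ^ 2) * X ^ (h + k - 1)).degree <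
          ((h + k - 1 : ℕ) : WithBot ℕ) := by
        have hd : (q * g ^ 2).degree = ((h + k - 1 : ℕ) : WithBot ℕ) := by
          rw [degree_mul, degree_pow, hqdeg, degree_eq_natDegree hg0, ← hgd]
          norm_cast
        have hc0 : c ^ 2 ≠ 0 := pow_ne_zero _ (leadingCoeff_ne_zero.mpr hg0)
        have := degree_sub_lt_left (p := q * g ^ 2) (q := C (c ^ 2) * X ^ (h + k - 1))
          (by rw [hd, degree_C_mul_X_pow _ hc0])
          (mul_ne_zero hq.ne_zero (pow_ne_zero _ hg0))
          (by rw [leadingCoeff_mul, leadingCoeff_pow, hq.leadingCoeff, one_mul,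
            leadingCoeff_C_mul_X_pow])
        rwa [hd] at this
      have h2 : q * (q * g ^ 2) = (c ^ 2) • (q * X ^ (h + k - 1)) +
          q * (q * g ^ 2 - C (c ^ 2) * X ^ (h + k - 1)) := by
        rw [smul_eq_C_mul]; ring
      rw [h2, map_add, hsmall _ hlow, add_zero, map_smul, smul_eq_mul]
      exact mul_nonneg (sq_nonneg c) hc

/-- Both functionals are processed in parallel, jumping from one nonzero minor to the next, so that
the dimensions z and z' are the same for the two. A jump of even length k adds k/2 to each of them.
For odd k the extra dimension goes where the sign of L(qX^(h+k-1)) directs, and that sign is read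
from the two minors at the ends of the jump. -/
theorem exists_hasNonnegSubspace_of_sign_eq (L L' : R[X] →ₗ[R] R) (n : ℕ)
    (hs : ∀ j ≤ n, SignType.sign (hankelMinor L j) = SignType.sign (hankelMinor L' j))
    (hn : hankelMinor L n ≠ 0) :
    ∃ z z', z + z' = n ∧ HasNonnegSubspace L n z ∧ HasNonnegSubspace (-L) n z' ∧
      HasNonnegSubspace L' n z ∧ HasNonnegSubspace (-L') n z' := by
  induction n using Nat.strong_induction_on with
  | _ n ih =>
    rcases Nat.eq_zero_or_pos n with rfl | hpos
    · exact ⟨0, 0, rfl, .zero _, .zero _, .zero _, .zero _⟩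
    have hzero : ∀ j ≤ n, hankelMinor L j = 0 ↔ hankelMinor L' j = 0 := fun j hj => by
      rw [← sign_eq_zero_iff, hs j hj, sign_eq_zero_iff]
    obtain ⟨h, hhn, hD, hmax⟩ : ∃ h < n, hankelMinor L h ≠ 0 ∧
        ∀ j, h < j → j < n → hankelMinor L j = 0 := by
      classical
      let S := (Finset.range n).filter fun j => hankelMinor L j ≠ 0
      have hS : S.Nonempty := ⟨0, by simp [S, hpos, hankelMinor_zero]⟩
      have hmem := S.max'_mem hS
      simp only [S, Finset.mem_filter, Finset.mem_range] at hmem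
      refine ⟨S.max' hS, hmem.1, hmem.2, fun j h1 h2 => ?_⟩
      by_contra h3
      exact absurd (S.le_max' j (by simp [S, h2, h3])) (not_le.mpr h1)
    obtain ⟨z, z', hz, hZ1, hZ2, hZ3, hZ4⟩ := ih h hhn (fun j hj => hs j (by omega)) hD
    obtain ⟨k, rfl⟩ : ∃ k, n = h + k := ⟨n - h, by omega⟩
    have hD' : hankelMinor L' h ≠ 0 := fun h0 => hD ((hzero h (by omega)).mpr h0)
    obtain ⟨q, hq, hqd, hqL⟩ := exists_orthogonal_of_hankelMinor_ne_zero L hD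
    obtain ⟨q', hq', hqd', hqL'⟩ := exists_orthogonal_of_hankelMinor_ne_zero L' hD'
    have hg := apply_orthogonal_eq_zero_of_gap L hq hqd hqL hD hmax
    have hg' := apply_orthogonal_eq_zero_of_gap L' hq' hqd' hqL' hD'
      (fun j h1 h2 => (hzero j (by omega)).mp (hmax j h1 h2))
    have hgn : ∀ j, j + 1 < h + k → (-L) (q * X ^ j) = 0 := fun j hj => by
      rw [LinearMap.neg_apply, hg j hj, neg_zero]
    have hgn' : ∀ j, j + 1 < h + k → (-L') (q' * X ^ j) = 0 := fun j hj => by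
      rw [LinearMap.neg_apply, hg' j hj, neg_zero]
    rcases Nat.even_or_odd' k with ⟨m, rfl | rfl⟩
    · exact ⟨z + m, z' + m, by omega, hZ1.add hq hqd hg (.inl le_rfl),
        hZ2.add hq hqd hgn (.inl le_rfl), hZ3.add hq' hqd' hg' (.inl le_rfl),
        hZ4.add hq' hqd' hgn' (.inl le_rfl)⟩
    · set c := L (q * X ^ (h + (2 * m + 1) - 1)) with hc
      set c' := L' (q' * X ^ (h + (2 * m + 1) - 1)) with hc'
      have h1 := hankelMinor_add L hq hqd hg
      have h2 := hankelMinor_add L' hq' hqd' hg'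
      have hcn : c ≠ 0 := by
        intro h0
        rw [← hc, h0, zero_pow (by omega), mul_zero, mul_zero] at h1
        exact hn h1
      have hsc : SignType.sign c = SignType.sign c' := by
        have h3 := hs _ le_rfl
        have hodd : ∀ x : R, SignType.sign (x ^ (2 * m + 1)) = SignType.sign x := by
          intro x
          rcases lt_trichotomy x 0 with hx | rfl | hx
          · rw [sign_neg hx, sign_neg ((odd_two_mul_add_one m).pow_neg hx)]
          · rw [zero_pow (by omega)]
          · rw [sign_pos hx, sign_pos (pow_pos hx _)]
        rw [h1, h2, sign_mul, sign_mul, sign_mul, sign_mul, hs h (by omega), hodd, hodd] at h3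
        have ha : SignType.sign (hankelMinor L' h) ≠ 0 := by rwa [Ne, sign_eq_zero_iff]
        have hb : SignType.sign (reverseSign R (2 * m + 1)) ≠ 0 := by
          rw [Ne, sign_eq_zero_iff]; exact reverseSign_ne_zero _
        exact mul_left_cancel₀ hb (mul_left_cancel₀ ha h3)
      rcases lt_or_gt_of_ne hcn with hneg | hpos
      · have hneg' : c' < 0 := by rwa [← sign_eq_neg_one_iff, ← hsc, sign_eq_neg_one_iff]
        exact ⟨z + m, z' + (m + 1), by omega, hZ1.add hq hqd hg (.inl (by omega)),
          hZ2.add hq hqd hgn (.inr ⟨by omega, (neg_pos.mpr hneg).le⟩),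
          hZ3.add hq' hqd' hg' (.inl (by omega)),
          hZ4.add hq' hqd' hgn' (.inr ⟨by omega, (neg_pos.mpr hneg').le⟩)⟩
      · have hpos' : 0 < c' := by rwa [← sign_eq_one_iff, ← hsc, sign_eq_one_iff]
        exact ⟨z + (m + 1), z' + m, by omega, hZ1.add hq hqd hg (.inr ⟨by omega, hpos.le⟩),
          hZ2.add hq hqd hgn (.inl (by omega)),
          hZ3.add hq' hqd' hg' (.inr ⟨by omega, hpos'.le⟩),
          hZ4.add hq' hqd' hgn' (.inl (by omega))⟩

/-- Sylvester's inertia: a vector of the space killed by all coordinates of positive weight has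
nonpositive value, hence value zero, so every coordinate of nonzero weight kills it too. -/
theorem HasNonnegSubspace.le_card_pos {L : R[X] →ₗ[R] R} {n z : ℕ} (hZ : HasNonnegSubspace L n z)
    {ι : Type*} [Fintype ι] (w : ι → R) (l : ι → R[X] →ₗ[R] R)
    (hL : ∀ f, L (f * f) = ∑ i, w i * l i f ^ 2)
    (hinj : ∀ f ∈ degreeLT R n, (∀ i, w i ≠ 0 → l i f = 0) → f = 0) :
    z ≤ (Finset.univ.filter fun i => 0 < w i).card := by
  obtain ⟨Z, hZd, rfl, hZL⟩ := hZ
  let φ : Z →ₗ[R] ({i // 0 < w i} → R) := LinearMap.pi fun i => l i ∘ₗ Z.subtype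
  have hφ : Function.Injective φ := by
    rw [← LinearMap.ker_eq_bot, eq_bot_iff]
    rintro ⟨f, hf⟩ hφf
    have hpos : ∀ i, 0 < w i → l i f = 0 := fun i hi =>
      congr_fun (LinearMap.mem_ker.mp hφf) ⟨i, hi⟩
    have hterm : ∀ i ∈ Finset.univ, w i * l i f ^ 2 ≤ 0 := by
      intro i _
      rcases lt_or_ge 0 (w i) with hi | hi
      · rw [hpos i hi]; simp
      · exact mul_nonpos_of_nonpos_of_nonneg hi (sq_nonneg _)
    have hsum : ∑ i, w i * l i f ^ 2 = 0 :=
      le_antisymm (Finset.sum_nonpos hterm) (hL f ▸ hZL f hf)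
    have hz := (Finset.sum_eq_zero_iff_of_nonpos hterm).mp hsum
    refine (Submodule.mem_bot R).mpr (Subtype.ext (hinj f (hZd hf) fun i hi => ?_))
    exact pow_eq_zero_iff two_ne_zero |>.mp
      ((mul_eq_zero.mp (hz i (Finset.mem_univ i))).resolve_left hi)
  have := LinearMap.finrank_le_finrank_of_injective hφ
  rwa [Module.finrank_fintype_fun_eq_card, Fintype.card_subtype] at this

/-- The two inequalities of inertia have equal sums on both sides, so both are equalities. -/
theorem card_pos_and_card_neg_eq {L : R[X] →ₗ[R] R} {n z z' : ℕ}
    (hz : z + z' = n) (hZ : HasNonnegSubspace L n z) (hZ' : HasNonnegSubspace (-L) n z')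
    {ι : Type*} [Fintype ι] (w : ι → R) (l : ι → R[X] →ₗ[R] R)
    (hL : ∀ f, L (f * f) = ∑ i, w i * l i f ^ 2)
    (hinj : ∀ f ∈ degreeLT R n, (∀ i, w i ≠ 0 → l i f = 0) → f = 0)
    (hw : (Finset.univ.filter fun i => w i ≠ 0).card = n) :
    (Finset.univ.filter fun i => 0 < w i).card = z ∧
      (Finset.univ.filter fun i => w i < 0).card = z' := by
  classical
  have e1 := hZ.le_card_pos w l hL hinj
  have e2 := hZ'.le_card_pos (-w) l (fun f => by
    rw [LinearMap.neg_apply, hL, ← Finset.sum_neg_distrib]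
    exact Finset.sum_congr rfl fun i _ => by rw [Pi.neg_apply, neg_mul])
    (fun f hf h => hinj f hf fun i hi0 => h i (by rwa [Pi.neg_apply, neg_ne_zero]))
  simp only [Pi.neg_apply, neg_pos] at e2
  have e3 : (Finset.univ.filter fun i => 0 < w i).card +
      (Finset.univ.filter fun i => w i < 0).card = (Finset.univ.filter fun i => w i ≠ 0).card := by
    rw [← Finset.card_union_of_disjoint
      (Finset.disjoint_filter.mpr fun i _ h1 h2 => lt_asymm h1 h2), ← Finset.filter_or]
    congr 1
    refine Finset.filter_congr fun i _ => ?_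
    rw [or_comm]; exact lt_or_lt_iff_ne
  omega

theorem card_pos_eq_of_hankelMinor_sign_eq {L L' : R[X] →ₗ[R] R} {n : ℕ}
    (hs : ∀ j ≤ n, SignType.sign (hankelMinor L j) = SignType.sign (hankelMinor L' j))
    (hn : hankelMinor L n ≠ 0) {ι ι' : Type*} [Fintype ι] [Fintype ι']
    (w : ι → R) (l : ι → R[X] →ₗ[R] R) (hL : ∀ f, L (f * f) = ∑ i, w i * l i f ^ 2)
    (hinj : ∀ f ∈ degreeLT R n, (∀ i, w i ≠ 0 → l i f = 0) → f = 0)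
    (hw : (Finset.univ.filter fun i => w i ≠ 0).card = n)
    (w' : ι' → R) (l' : ι' → R[X] →ₗ[R] R) (hL' : ∀ f, L' (f * f) = ∑ i, w' i * l' i f ^ 2)
    (hinj' : ∀ f ∈ degreeLT R n, (∀ i, w' i ≠ 0 → l' i f = 0) → f = 0)
    (hw' : (Finset.univ.filter fun i => w' i ≠ 0).card = n) :
    (Finset.univ.filter fun i => 0 < w i).card = (Finset.univ.filter fun i => 0 < w' i).card ∧
    (Finset.univ.filter fun i => w i < 0).card = (Finset.univ.filter fun i => w' i < 0).card := by
  obtain ⟨z, z', hz, h1, h2, h3, h4⟩ := exists_hasNonnegSubspace_of_sign_eq L L' n hs hn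
  obtain ⟨a1, a2⟩ := card_pos_and_card_neg_eq hz h1 h2 w l hL hinj hw
  obtain ⟨b1, b2⟩ := card_pos_and_card_neg_eq hz h3 h4 w' l' hL' hinj' hw'
  exact ⟨a1.trans b1.symm, a2.trans b2.symm⟩

end Inertia

/-! ### Recovering a multiset of sign vectors from sparse moments. -/

section SignDetermination

theorem sum_filter_sign_eq_zero {X : Type*} (T : Finset X) (g : X → ℤ) (s : X → SignType)
    (h : ∀ e : Fin 3, ∑ x ∈ T, g x * (s x : ℤ) ^ (e : ℕ) = 0) (ε : SignType) :
    ∑ x ∈ T with s x = ε, g x = 0 := by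
  have h0 := h 0
  have h1 := h 1
  have h2 := h 2
  simp only [Fin.val_zero, Fin.val_one, Fin.val_two, pow_zero, mul_one, pow_one] at h0 h1 h2
  rw [Finset.sum_filter]
  -- Lagrange interpolation on {-1, 0, 1}: twice the indicator of ε is an integral quadratic
  -- polynomial in the sign.
  have key : ∀ (c0 c1 c2 : ℤ), (∀ σ : SignType, (if σ = ε then (2 : ℤ) else 0) =
      c0 + c1 * (σ : ℤ) + c2 * (σ : ℤ) ^ 2) →
      2 * ∑ x ∈ T, (if s x = ε then g x else 0) = 0 := by
    intro c0 c1 c2 hc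
    have : 2 * ∑ x ∈ T, (if s x = ε then g x else 0) =
        c0 * ∑ x ∈ T, g x + c1 * ∑ x ∈ T, g x * (s x : ℤ) +
          c2 * ∑ x ∈ T, g x * (s x : ℤ) ^ 2 := by
      simp only [Finset.mul_sum, ← Finset.sum_add_distrib]
      refine Finset.sum_congr rfl fun x _ => ?_
      have := hc (s x)
      split_ifs at this ⊢ <;> linear_combination (g x) * this
    rw [this, h0, h1, h2]; ring
  have : 2 * ∑ x ∈ T, (if s x = ε then g x else 0) = 0 := by
    cases ε
    · exact key 2 0 (-2) (by decide)
    · exact key 0 (-1) 1 (by decide)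
    · exact key 0 1 1 (by decide)
  omega

/-- Induction on the coordinates. A coordinate constant on the support can be dropped. Otherwise it
takes two values, and interpolating in it costs one active exponent: each fibre has vanishing
moments with w - 1 active coordinates, hence at least 2^w points. -/
theorem two_pow_le_card_of_moments_eq_zero {ι : Type*} [DecidableEq ι] (s : Finset ι) :
    ∀ (w : ℕ) (T : Finset (ι → SignType)) (g : (ι → SignType) → ℤ), T.Nonempty →
    (∀ x ∈ T, g x ≠ 0) → (∀ x ∈ T, ∀ y ∈ T, ∀ i ∉ s, x i = y i) →
    (∀ α : ι → Fin 3, (s.filter fun i => α i ≠ 0).card ≤ w →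
      ∑ x ∈ T, g x * ∏ i ∈ s, (x i : ℤ) ^ (α i : ℕ) = 0) → 2 ^ (w + 1) ≤ T.card := by
  induction s using Finset.induction_on with
  | empty =>
    intro w T g hT hg hs hα
    exfalso
    obtain ⟨x, hx⟩ := hT
    have hTx : T = {x} := Finset.eq_singleton_iff_unique_mem.mpr
      ⟨hx, fun y hy => funext fun i => hs y hy x hx i (Finset.notMem_empty i)⟩
    have := hα 0 (by simp)
    rw [hTx] at this
    simp only [Finset.sum_singleton, Finset.prod_empty, mul_one] at this
    exact hg x hx this
  | insert a s ha ih =>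
    intro w T g hT hg hs hα
    have hmono : ∀ {α : ι → Fin 3} (e : Fin 3),
        ((insert a s).filter fun i => Function.update α a e i ≠ 0).card ≤
          (s.filter fun i => α i ≠ 0).card + (if e = 0 then 0 else 1) := by
      intro α e
      rw [Finset.filter_insert, Function.update_self]
      have h1 : (s.filter fun i => Function.update α a e i ≠ 0) = s.filter fun i => α i ≠ 0 := by
        refine Finset.filter_congr fun i hi => ?_
        rw [Function.update_of_ne (ne_of_mem_of_not_mem hi ha)]
      rw [h1]
      by_cases he : e = 0
      · simp [he]
      · simpa [he] using Finset.card_insert_le _ _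
    have hprod : ∀ (α : ι → Fin 3) (e : Fin 3) (x : ι → SignType),
        ∏ i ∈ insert a s, (x i : ℤ) ^ (Function.update α a e i : ℕ) =
          (∏ i ∈ s, (x i : ℤ) ^ (α i : ℕ)) * (x a : ℤ) ^ (e : ℕ) := by
      intro α e x
      rw [Finset.prod_insert ha, Function.update_self, mul_comm]
      congr 1
      refine Finset.prod_congr rfl fun i hi => ?_
      rw [Function.update_of_ne (ne_of_mem_of_not_mem hi ha)]
    by_cases hconst : ∀ x ∈ T, ∀ y ∈ T, x a = y a
    · refine ih w T g hT hg ?_ ?_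
      · intro x hx y hy i hi
        by_cases hia : i = a
        · exact hia ▸ hconst x hx y hy
        · exact hs x hx y hy i (by simp [hia, hi])
      · intro α hαw
        have := hα (Function.update α a 0) ((hmono 0).trans (by simpa using hαw))
        simpa only [hprod, Fin.val_zero, pow_zero, mul_one] using this
    · classical
      push Not at hconst
      obtain ⟨x, hx, y, hy, hxy⟩ := hconst
      have hdisj : Disjoint (T.filter fun z => z a = x a) (T.filter fun z => z a = y a) :=
        Finset.disjoint_filter.mpr fun z _ h1 h2 => hxy (h1.symm.trans h2)
      have hsub : (T.filter fun z => z a = x a) ∪ (T.filter fun z => z a = y a) ⊆ T :=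
        Finset.union_subset (Finset.filter_subset _ _) (Finset.filter_subset _ _)
      have hcard := Finset.card_le_card hsub
      rw [Finset.card_union_of_disjoint hdisj] at hcard
      have key : ∀ z ∈ T, 2 ^ w ≤ (T.filter fun t => t a = z a).card := by
        intro z hz
        have hne : (T.filter fun t => t a = z a).Nonempty := ⟨z, by simp [hz]⟩
        rcases w with _ | w
        · exact Finset.card_pos.mpr hne
        refine ih w _ g hne (fun t ht => hg t (Finset.mem_of_mem_filter t ht)) ?_ ?_
        · intro t ht u hu i hi
          rw [Finset.mem_filter] at ht hu
          by_cases hia : i = a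
          · rw [hia, ht.2, hu.2]
          · exact hs t ht.1 u hu.1 i (by simp [hia, hi])
        · intro α hαw
          refine sum_filter_sign_eq_zero T (fun t => g t * ∏ i ∈ s, (t i : ℤ) ^ (α i : ℕ))
            (fun t => t a) (fun e => ?_) (z a)
          have := hα (Function.update α a e) ((hmono e).trans (by split_ifs <;> omega))
          simpa only [hprod, mul_assoc] using this
      have h1 := key x hx
      have h2 := key y hy
      rw [pow_succ]; omega

/-- If M and M' differed, the difference of their counts would be supported on fewer than 2^(w+1)
points while all its moments with at most w active coordinates vanish. -/
theorem eq_of_moments_eq {ι : Type*} [Fintype ι] (w : ℕ) (M M' : Multiset (ι → SignType))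
    (hM : M.card < 2 ^ w) (hM' : M'.card < 2 ^ w)
    (h : ∀ α : ι → Fin 3, (Finset.univ.filter fun i => α i ≠ 0).card ≤ w →
      (M.map fun x => ∏ i, (x i : ℤ) ^ (α i : ℕ)).sum =
        (M'.map fun x => ∏ i, (x i : ℤ) ^ (α i : ℕ)).sum) : M = M' := by
  classical
  by_contra hne
  let g : (ι → SignType) → ℤ := fun x => (M.count x : ℤ) - M'.count x
  let T : Finset (ι → SignType) := (M.toFinset ∪ M'.toFinset).filter fun x => g x ≠ 0
  have hT : T.Nonempty := by
    by_contra hT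
    refine hne (Multiset.ext.mpr fun x => ?_)
    by_contra hx
    refine hT ⟨x, ?_⟩
    simp only [T, g, Finset.mem_filter, Finset.mem_union, Multiset.mem_toFinset, ne_eq]
    refine ⟨?_, by omega⟩
    by_contra! h2
    exact hx (by rw [Multiset.count_eq_zero_of_notMem h2.1, Multiset.count_eq_zero_of_notMem h2.2])
  have hsum : ∀ (N : Multiset (ι → SignType)), N.toFinset ⊆ M.toFinset ∪ M'.toFinset →
      ∀ f : (ι → SignType) → ℤ,
      (N.map f).sum = ∑ x ∈ M.toFinset ∪ M'.toFinset, (N.count x : ℤ) * f x := by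
    intro N hN f
    rw [Finset.sum_multiset_map_count]
    simp only [nsmul_eq_mul]
    refine Finset.sum_subset hN fun x _ hx => ?_
    rw [Multiset.mem_toFinset] at hx
    rw [Multiset.count_eq_zero_of_notMem hx]; simp
  have hcard := two_pow_le_card_of_moments_eq_zero (Finset.univ : Finset ι) w T g hT
    (fun x hx => (Finset.mem_filter.mp hx).2) (fun _ _ _ _ i hi => absurd (Finset.mem_univ i) hi)
    (fun α hα => by
      have := h α hα
      rw [hsum M Finset.subset_union_left, hsum M' Finset.subset_union_right, ← sub_eq_zero,
        ← Finset.sum_sub_distrib] at this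
      rw [← this, Finset.sum_filter_of_ne
        (fun x _ hx => show g x ≠ 0 from fun h0 => hx (by rw [h0, zero_mul]))]
      exact Finset.sum_congr rfl fun x _ => by simp only [g]; ring)
  have h1 : T.card ≤ M.card + M'.card :=
    (Finset.card_filter_le _ _).trans ((Finset.card_union_le _ _).trans
      (add_le_add (Multiset.toFinset_card_le _) (Multiset.toFinset_card_le _)))
  rw [pow_succ] at hcard
  omega

end SignDetermination

/-! ### Rank of Hankel matrices of weighted power sums. -/

section Vandermonde

variable {C : Type*} [Field C] {ι : Type*} [Fintype ι]

theorem sum_mul_pow_eq_mul [DecidableEq C] (w ρ : ι → C) (n : ℕ) :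
    (Matrix.of fun i j : Fin n => ∑ k, w k * ρ k ^ ((i : ℕ) + (j : ℕ))) =
      (Matrix.of fun (i : Fin n) (k : {k // w k ≠ 0}) => w k * ρ k ^ (i : ℕ)) *
        (Matrix.of fun (k : {k // w k ≠ 0}) (j : Fin n) => ρ k ^ (j : ℕ)) := by
  ext i j
  rw [Matrix.mul_apply]
  simp only [Matrix.of_apply]
  rw [← Finset.sum_subtype (Finset.univ.filter fun k => w k ≠ 0) (by simp)
    (fun k => w k * ρ k ^ (i : ℕ) * ρ k ^ (j : ℕ)), Finset.sum_filter_of_ne]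
  · exact Finset.sum_congr rfl fun k _ => by rw [pow_add, mul_assoc]
  · intro k _ hk h0
    rw [h0, zero_mul, zero_mul] at hk
    exact hk rfl

theorem det_sum_mul_pow_eq_zero [DecidableEq C] (w ρ : ι → C) {n : ℕ}
    (hn : (Finset.univ.filter fun k => w k ≠ 0).card < n) :
    (Matrix.of fun i j : Fin n => ∑ k, w k * ρ k ^ ((i : ℕ) + (j : ℕ))).det = 0 := by
  by_contra h
  have h1 := Matrix.rank_of_isUnit _ ((Matrix.isUnit_iff_isUnit_det _).mpr (isUnit_iff_ne_zero.mpr h))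
  rw [sum_mul_pow_eq_mul, Fintype.card_fin] at h1
  have h2 := (Matrix.rank_mul_le_left
    (Matrix.of fun (i : Fin n) (k : {k // w k ≠ 0}) => w k * ρ k ^ (i : ℕ))
    (Matrix.of fun (k : {k // w k ≠ 0}) (j : Fin n) => ρ k ^ (j : ℕ))).trans
      (Matrix.rank_le_card_width _)
  rw [Fintype.card_subtype] at h2
  omega

theorem det_sum_mul_pow_ne_zero [DecidableEq C] (w ρ : ι → C) (hρ : Function.Injective ρ) {n : ℕ}
    (hn : (Finset.univ.filter fun k => w k ≠ 0).card = n) :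
    (Matrix.of fun i j : Fin n => ∑ k, w k * ρ k ^ ((i : ℕ) + (j : ℕ))).det ≠ 0 := by
  have hc : Fintype.card {k // w k ≠ 0} = n := by rw [Fintype.card_subtype, hn]
  let e : Fin n ≃ {k // w k ≠ 0} := (Fintype.equivFinOfCardEq hc).symm
  let V := Matrix.vandermonde fun a => ρ (e a)
  have h : (Matrix.of fun i j : Fin n => ∑ k, w k * ρ k ^ ((i : ℕ) + (j : ℕ))) =
      V.transpose * Matrix.diagonal (fun a => w (e a)) * V := by
    rw [sum_mul_pow_eq_mul]
    ext i j
    rw [Matrix.mul_apply, Matrix.mul_apply, ← e.sum_comp]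
    refine Finset.sum_congr rfl fun a _ => ?_
    rw [Matrix.mul_diagonal]
    simp only [V, Matrix.transpose_apply, Matrix.vandermonde_apply, Matrix.of_apply]
    ring
  rw [h, Matrix.det_mul, Matrix.det_mul, Matrix.det_transpose, Matrix.det_diagonal]
  have hV : V.det ≠ 0 := Matrix.det_vandermonde_ne_zero_iff.mpr
    (hρ.comp (Subtype.val_injective.comp e.injective))
  exact mul_ne_zero (mul_ne_zero hV (Finset.prod_ne_zero_iff.mpr fun a _ => (e a).2)) hV

end Vandermonde

/-! ### Multiplicity read off the vanishing of derivatives. -/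

section Multiplicity

theorem DerSign.plus_zero {p : ℕ} (η : DerSign p) : η.plus 0 = 0 := if_pos rfl

theorem DerSign.plus_of_mem {p : ℕ} (η : DerSign p) {h : ℕ} (hh : h ∈ Finset.Icc 1 (p - 1)) :
    η.plus h = η ⟨h, hh⟩ := by
  rw [DerSign.plus, if_neg (by rw [Finset.mem_Icc] at hh; omega), dif_pos hh]

theorem DerSign.plus_self {p : ℕ} (hp : 1 ≤ p) (η : DerSign p) : η.plus p = 1 := by
  rw [DerSign.plus, if_neg (by omega), dif_neg (by rw [Finset.mem_Icc]; omega)]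

/-- Only the zeros of `η` matter, so the same lemma serves Thom encodings of real roots and
vanishing patterns of roots in R(i). -/
theorem DerSign.mu_eq_rootMultiplicity {C : Type*} [Field C] [CharZero C] {G : C[X]}
    {p : ℕ} (hp : 1 ≤ p) (hd : G.natDegree = p) {z : C} (hz : G.IsRoot z)
    (η : DerSign p) (hη : ∀ h : Finset.Icc 1 (p - 1),
      η h = 0 ↔ (derivative^[(h : ℕ)] G).IsRoot z) : η.mu = rootMultiplicity z G := by
  have hG : G ≠ 0 := by rintro rfl; rw [natDegree_zero] at hd; omega
  have hle : rootMultiplicity z G ≤ p := by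
    classical
    rw [← hd, ← count_roots]; exact (Multiset.count_le_card _ _).trans (card_roots' G)
  have hzero : ∀ i < rootMultiplicity z G, η.plus i = 0 := by
    intro i hi
    rcases Nat.eq_zero_or_pos i with rfl | hpos
    · exact η.plus_zero
    have hmem : i ∈ Finset.Icc 1 (p - 1) := Finset.mem_Icc.mpr ⟨hpos, by omega⟩
    rw [η.plus_of_mem hmem, hη]
    exact (lt_rootMultiplicity_iff_isRoot_iterate_derivative hG).mp hi i le_rfl
  have hne : η.plus (rootMultiplicity z G) ≠ 0 := by
    rcases hle.eq_or_lt with h | h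
    · rw [h, η.plus_self hp]; exact one_ne_zero
    have hpos := (rootMultiplicity_pos hG).mpr hz
    have hmem : rootMultiplicity z G ∈ Finset.Icc 1 (p - 1) :=
      Finset.mem_Icc.mpr ⟨hpos, by omega⟩
    intro h0
    rw [η.plus_of_mem hmem, hη] at h0
    refine lt_irrefl (rootMultiplicity z G) ((lt_rootMultiplicity_iff_isRoot_iterate_derivative hG).mpr
      fun m hm => ?_)
    rcases hm.eq_or_lt with rfl | hm
    · exact h0
    · exact (lt_rootMultiplicity_iff_isRoot_iterate_derivative hG).mp hm m le_rfl
  refine le_antisymm (Nat.sInf_le hne) ?_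
  by_contra! hlt
  exact Nat.sInf_mem (⟨_, hne⟩ : {i | η.plus i ≠ 0}.Nonempty) (hzero _ hlt)

end Multiplicity

/-! ### Thom's lemma and the order on encodings. -/

section ThomEncoding

theorem ThomLT.asymm {p : ℕ} (hp : 1 ≤ p) {η η' : DerSign p} (h : ThomLT p η.plus η'.plus)
    (h' : ThomLT p η'.plus η.plus) : False := by
  obtain ⟨q, hq, hne, heq, hs⟩ := h
  obtain ⟨q', hq', hne', heq', hs'⟩ := h'
  obtain rfl : q = q' := by
    rcases lt_trichotomy q q' with h | h | h
    · exact absurd (heq q' h hq').symm hne'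
    · exact h
    · exact absurd (heq' q h hq).symm hne
  have hsucc : η.plus (q + 1) = η'.plus (q + 1) := by
    rcases (Nat.succ_le_of_lt hq).eq_or_lt with h | h
    · rw [Nat.succ_eq_add_one] at h
      rw [h, η.plus_self hp, η'.plus_self hp]
    · exact heq _ (Nat.lt_succ_self q) h
  rw [← hsucc] at hs'
  rcases hs with ⟨h1, h2⟩ | ⟨h1, h2⟩ <;> rcases hs' with ⟨h3, h4⟩ | ⟨h3, h4⟩
  · exact lt_asymm h1 h3
  · rw [h2] at h4; exact absurd h4 (by decide)
  · rw [h2] at h4; exact absurd h4 (by decide)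
  · exact lt_asymm h1 h3

theorem ThomMuLT.asymm {p : ℕ} (hp : 1 ≤ p) {η η' : DerSign p} (h : ThomMuLT η η')
    (h' : ThomMuLT η' η) : False := by
  rcases h with h | ⟨h, h1⟩ <;> rcases h' with h' | ⟨h', h2⟩
  · omega
  · omega
  · omega
  · exact h1.asymm hp h2

variable {R : Type*} [Field R] [LinearOrder R]

/-- The Thom encoding of `x` as a root of a polynomial `F` of degree `p`: the signs at `x` of the
derivatives of `F` of orders `1, …, p - 1`. -/
noncomputable def thomEncoding (p : ℕ) (F : R[X]) (x : R) : DerSign p :=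
  fun h => SignType.sign ((derivative^[(h : ℕ)] F).eval x)

variable [IsStrictOrderedRing R]

theorem eval_iterate_derivative_natDegree {F : R[X]} (hF : F.Monic) (x : R) :
    0 < (derivative^[F.natDegree] F).eval x := by
  have h1 : (derivative^[F.natDegree] F).natDegree = 0 := by
    have := natDegree_iterate_derivative F F.natDegree
    omega
  rw [eq_C_of_natDegree_eq_zero h1, eval_C, coeff_iterate_derivative, zero_add,
    hF.coeff_natDegree, nsmul_one, Nat.descFactorial_self]
  exact_mod_cast Nat.factorial_pos _

theorem thomEncoding_plus {p : ℕ} (hp : 1 ≤ p) {F : R[X]} (hF : F.Monic) (hd : F.natDegree = p)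
    {x : R} (hx : F.eval x = 0) {h : ℕ} (hh : h ≤ p) :
    (thomEncoding p F x).plus h = SignType.sign ((derivative^[h] F).eval x) := by
  rcases Nat.eq_zero_or_pos h with rfl | hpos
  · rw [DerSign.plus_zero, Function.iterate_zero, id, hx, sign_zero]
  rcases hh.eq_or_lt with rfl | hlt
  · rw [DerSign.plus_self hp, sign_pos (hd ▸ eval_iterate_derivative_natDegree hF x)]
  · rw [DerSign.plus_of_mem _ (Finset.mem_Icc.mpr ⟨hpos, by omega⟩)]; rfl

variable [IsRealClosed R]

theorem eval_lt_or_gt_of_sign_derivative {G : R[X]} {x y : R} {σ : SignType}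
    (hσ : σ ≠ 0) (h : ∀ t, x ≤ t → t ≤ y → SignType.sign ((derivative G).eval t) = σ) :
    ∀ s t, x ≤ s → s < t → t ≤ y → (σ = 1 ∧ G.eval s < G.eval t) ∨
      (σ = -1 ∧ G.eval t < G.eval s) := by
  intro s t hs hst ht
  cases σ
  · exact absurd rfl hσ
  · right
    refine ⟨rfl, ?_⟩
    have := eval_lt_eval_of_derivative_pos (f := -G) hst (fun z h1 h2 => by
      have := sign_eq_neg_one_iff.mp (h z (by linarith) (by linarith))
      rw [derivative_neg, eval_neg]; linarith)
    rw [eval_neg, eval_neg] at this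
    linarith
  · left
    exact ⟨rfl, eval_lt_eval_of_derivative_pos hst fun z h1 h2 =>
      sign_eq_one_iff.mp (h z (by linarith) (by linarith))⟩

/-- Descending induction on the order of derivation: F^(q+1) has constant nonzero sign, so F^(q) is
strictly monotone. Its end values are distinct and of equal sign, hence nonzero, and it lies between
them. -/
theorem exists_const_sign_of_sign_eq {F : R[X]} (hF : F.Monic) {x y : R} (hxy : x < y) :
    ∀ d q, q + d = F.natDegree → (∀ h, q ≤ h → h ≤ F.natDegree →
      SignType.sign ((derivative^[h] F).eval x) = SignType.sign ((derivative^[h] F).eval y)) →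
    ∃ σ : SignType, σ ≠ 0 ∧
      ∀ t, x ≤ t → t ≤ y → SignType.sign ((derivative^[q] F).eval t) = σ := by
  intro d
  induction d with
  | zero =>
    rintro q hq -
    rw [add_zero] at hq
    subst hq
    exact ⟨1, by decide, fun t _ _ => sign_pos (eval_iterate_derivative_natDegree hF t)⟩
  | succ d ih =>
    intro q hq hs
    obtain ⟨σ, hσ, h⟩ := ih (q + 1) (by omega) fun h h1 h2 => hs h (by omega) h2
    simp only [Function.iterate_succ_apply'] at h
    have hmono := eval_lt_or_gt_of_sign_derivative hσ h
    have hsq := hs q le_rfl (by omega)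
    set G := derivative^[q] F
    have hle : ∀ t, x ≤ t → t ≤ y → (G.eval x ≤ G.eval t ∧ G.eval t ≤ G.eval y) ∨
        (G.eval y ≤ G.eval t ∧ G.eval t ≤ G.eval x) := by
      intro t h1 h2
      rcases h1.eq_or_lt with rfl | h1
      · exact (le_total (G.eval x) (G.eval y)).imp (fun h => ⟨le_rfl, h⟩) (fun h => ⟨h, le_rfl⟩)
      rcases h2.eq_or_lt with rfl | h2
      · exact (le_total (G.eval x) (G.eval t)).imp (fun h => ⟨h, le_rfl⟩) (fun h => ⟨le_rfl, h⟩)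
      rcases hmono x t le_rfl h1 h2.le with ⟨e1, e2⟩ | ⟨e1, e2⟩ <;>
        rcases hmono t y h1.le h2 le_rfl with ⟨e3, e4⟩ | ⟨e3, e4⟩
      · exact .inl ⟨e2.le, e4.le⟩
      · rw [e1] at e3; exact absurd e3 (by decide)
      · rw [e1] at e3; exact absurd e3 (by decide)
      · exact .inr ⟨e4.le, e2.le⟩
    have hne : G.eval x ≠ G.eval y := by
      rcases hmono x y le_rfl hxy le_rfl with ⟨-, e⟩ | ⟨-, e⟩
      · exact e.ne
      · exact e.ne'
    rcases lt_trichotomy (G.eval x) 0 with h0 | h0 | h0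
    · have hy : G.eval y < 0 := by rwa [← sign_eq_neg_one_iff, ← hsq, sign_eq_neg_one_iff]
      refine ⟨-1, by decide, fun t h1 h2 => sign_neg ?_⟩
      rcases hle t h1 h2 with ⟨e1, e2⟩ | ⟨e1, e2⟩ <;> linarith
    · rw [h0, sign_zero] at hsq
      exact absurd (h0.trans (sign_eq_zero_iff.mp hsq.symm).symm) hne
    · have hy : 0 < G.eval y := by rwa [← sign_eq_one_iff, ← hsq, sign_eq_one_iff]
      refine ⟨1, by decide, fun t h1 h2 => sign_pos ?_⟩
      rcases hle t h1 h2 with ⟨e1, e2⟩ | ⟨e1, e2⟩ <;> linarith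

theorem thomLT_thomEncoding {p : ℕ} (hp : 1 ≤ p) {F : R[X]} (hF : F.Monic)
    (hd : F.natDegree = p) {x y : R} (hx : F.eval x = 0) (hy : F.eval y = 0) (hxy : x < y) :
    ThomLT p (thomEncoding p F x).plus (thomEncoding p F y).plus := by
  let s : R → ℕ → SignType := fun z h => SignType.sign ((derivative^[h] F).eval z)
  have hsp : s x p = s y p := by
    change SignType.sign _ = SignType.sign _
    rw [← thomEncoding_plus hp hF hd hx le_rfl, ← thomEncoding_plus hp hF hd hy le_rfl,
      DerSign.plus_self hp, DerSign.plus_self hp]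
  obtain ⟨q, hqp, hne, hmax⟩ : ∃ q < p, s x q ≠ s y q ∧ ∀ j, q < j → j < p → s x j = s y j := by
    let S := (Finset.range p).filter fun j => s x j ≠ s y j
    have hS : S.Nonempty := by
      by_contra hS
      rw [Finset.not_nonempty_iff_eq_empty, Finset.filter_eq_empty_iff] at hS
      -- Equal encodings would give F itself a constant nonzero sign on [x, y], but F(x) = 0.
      obtain ⟨σ, hσ, h⟩ := exists_const_sign_of_sign_eq hF hxy p 0 (by rw [zero_add, hd])
        (fun h _ h2 => by
          rw [hd] at h2
          rcases h2.eq_or_lt with rfl | h2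
          · exact hsp
          · exact not_not.mp (hS (Finset.mem_range.mpr h2)))
      have := h x le_rfl hxy.le
      rw [Function.iterate_zero, id, hx, sign_zero] at this
      exact hσ this.symm
    have hmem := S.max'_mem hS
    simp only [S, Finset.mem_filter, Finset.mem_range] at hmem
    refine ⟨S.max' hS, hmem.1, hmem.2, fun j h1 h2 => ?_⟩
    by_contra h3
    exact absurd (S.le_max' j (by simp [S, h2, h3])) (not_le.mpr h1)
  -- Above the last difference q all signs agree, so F^(q+1) has constant sign; this decides whether
  -- F^(q) increases or decreases from x to y, which is the alternative in `ThomLT`.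
  obtain ⟨σ, hσ, h⟩ := exists_const_sign_of_sign_eq hF hxy (p - (q + 1)) (q + 1) (by omega)
    (fun j h1 h2 => by
      rw [hd] at h2
      rcases h2.eq_or_lt with rfl | h2
      · exact hsp
      · exact hmax j (by omega) h2)
  refine ⟨q, hqp, ?_, ?_, ?_⟩
  · rwa [thomEncoding_plus hp hF hd hx hqp.le, thomEncoding_plus hp hF hd hy hqp.le]
  · intro j h1 h2
    rw [thomEncoding_plus hp hF hd hx h2.le, thomEncoding_plus hp hF hd hy h2.le]
    exact hmax j h1 h2
  · rw [thomEncoding_plus hp hF hd hx hqp.le, thomEncoding_plus hp hF hd hy hqp.le,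
      thomEncoding_plus hp hF hd hx (Nat.succ_le_of_lt hqp), h x le_rfl hxy.le]
    simp only [Function.iterate_succ_apply'] at h
    rcases eval_lt_or_gt_of_sign_derivative hσ h x y le_rfl hxy le_rfl with ⟨e1, e2⟩ | ⟨e1, e2⟩
    · exact .inl ⟨lt_of_le_of_ne (SignType.sign.monotone e2.le) hne, e1⟩
    · exact .inr ⟨lt_of_le_of_ne (SignType.sign.monotone e2.le) (Ne.symm hne), e1⟩

end ThomEncoding

/-! ### Existence of the factorization and of the sorted encodings. -/

section Factorization

theorem exists_sorted_list {A B : Type*} [LinearOrder B] (S : Finset A) (key : A → B) :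
    ∃ l : List A, l.Nodup ∧ (∀ a, a ∈ l ↔ a ∈ S) ∧ l.Pairwise fun a b => key a ≤ key b := by
  classical
  let r : A → A → Prop := fun a b => key a ≤ key b
  have : Std.Total r := ⟨fun a b => le_total (key a) (key b)⟩
  have : IsTrans A r := ⟨fun _ _ _ h1 h2 => le_trans h1 h2⟩
  exact ⟨S.toList.insertionSort r, (List.perm_insertionSort r _).nodup_iff.mpr S.nodup_toList,
    fun a => by rw [List.mem_insertionSort, Finset.mem_toList], List.pairwise_insertionSort r _⟩

theorem prod_fin_map {A B M : Type*} [CommMonoid M] (l : List A) (f : A → B) (g : A → B → M) :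
    ∏ j : Fin (l.map f).length, g (l.get (Fin.cast (List.length_map _) j)) ((l.map f).get j) =
      (l.map fun a => g a (f a)).prod := by
  rw [← Fin.prod_univ_fun_getElem l fun a => g a (f a),
    ← (finCongr (List.length_map (as := l) f)).prod_comp]
  exact Finset.prod_congr rfl fun j _ => by simp

variable {R : Type*} [Field R]

theorem natDegree_quadratic (a b : R) : ((X - C a) ^ 2 + C b ^ 2 : R[X]).natDegree = 2 := by
  rw [← C_pow, natDegree_add_C, natDegree_pow, natDegree_X_sub_C]

theorem monic_quadratic (a b : R) : ((X - C a) ^ 2 + C b ^ 2 : R[X]).Monic := by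
  rw [← C_pow]; exact ((monic_X_sub_C a).pow 2).add_of_left (by
    rw [degree_pow, degree_X_sub_C]; exact degree_C_le.trans_lt (by norm_num))

theorem FactSystem.natDegree_eq {F : R[X]} {μ ν : List ℕ} {θ : Fin μ.length → R}
    {α β : Fin ν.length → R} (h : FactSystem F μ ν θ α β) : F.natDegree = μ.sum + 2 * ν.sum := by
  rw [h.eq_prod, Monic.natDegree_mul (monic_prod_of_monic _ _ fun j _ => (monic_X_sub_C _).pow _)
    (monic_prod_of_monic _ _ fun j _ => (monic_quadratic _ _).pow _),
    natDegree_prod_of_monic _ _ fun j _ => (monic_X_sub_C _).pow _,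
    natDegree_prod_of_monic _ _ fun j _ => (monic_quadratic _ _).pow _]
  simp only [natDegree_pow, natDegree_X_sub_C, natDegree_quadratic, mul_one]
  congr 1
  · exact (Fin.sum_univ_fun_getElem μ id).trans (by rw [List.map_id])
  · rw [← Finset.sum_mul, mul_comm]
    congr 1
    exact (Fin.sum_univ_fun_getElem ν id).trans (by rw [List.map_id])

variable [LinearOrder R] [IsStrictOrderedRing R]

theorem quadratic_eq_of_quadRes_eq_zero {a b a' b' : R} (h : quadRes a b a' b' = 0) :
    ((X - C a) ^ 2 + C b ^ 2 : R[X]) = (X - C a') ^ 2 + C b' ^ 2 := by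
  have key : ∀ x y : R, x ^ 2 + y ^ 2 = 0 → x = 0 ∧ y = 0 := fun x y hxy =>
    ⟨pow_eq_zero_iff two_ne_zero |>.mp (by nlinarith [sq_nonneg x, sq_nonneg y]),
      pow_eq_zero_iff two_ne_zero |>.mp (by nlinarith [sq_nonneg x, sq_nonneg y])⟩
  rcases mul_eq_zero.mp h with h | h
  · obtain ⟨h1, h2⟩ := key _ _ h
    rw [sub_eq_zero.mp h1, sub_eq_zero.mp h2]
  · obtain ⟨h1, h2⟩ := key _ _ h
    rw [sub_eq_zero.mp h1, eq_neg_of_add_eq_zero_left h2, C_neg, neg_sq]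

variable [IsRealClosed R]

theorem exists_quadratic_factors {G : R[X]} (hG : G.Monic) (hr : ∀ x, ¬ G.IsRoot x) :
    ∃ (ν : List ℕ) (α β : Fin ν.length → R), (∀ i ∈ ν, 1 ≤ i) ∧ ν.Pairwise (· ≥ ·) ∧
      G = ∏ k, ((X - C (α k)) ^ 2 + C (β k) ^ 2) ^ ν.get k ∧ (∀ k, β k ≠ 0) ∧
      ∀ k k', k < k' → quadRes (α k) (β k) (α k') (β k') ≠ 0 := by
  classical
  let N := UniqueFactorizationMonoid.normalizedFactors G
  have hN : N.prod = G := by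
    rw [UniqueFactorizationMonoid.prod_normalizedFactors_eq hG.ne_zero, hG.normalize_eq_self]
  obtain ⟨l, hnd, hmem, hsort⟩ := exists_sorted_list N.toFinset
    fun q => OrderDual.toDual (N.count q)
  have hquad : ∀ q ∈ N, ∃ ab : R × R, ab.2 ≠ 0 ∧ q = (X - C ab.1) ^ 2 + C ab.2 ^ 2 := by
    intro q hq
    have hirr := UniqueFactorizationMonoid.irreducible_of_normalized_factor q hq
    have hm : q.Monic := by
      rw [← UniqueFactorizationMonoid.normalize_normalized_factor q hq]
      exact monic_normalize hirr.ne_zero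
    obtain ⟨a, b, hb, h⟩ := irreducible_eq_quadratic hirr hm fun x hx =>
      hr x (hx.dvd (UniqueFactorizationMonoid.dvd_of_mem_normalizedFactors hq))
    exact ⟨(a, b), hb, h⟩
  have : Inhabited (R × R) := ⟨0⟩
  choose! ab hb hq using hquad
  have hlN : ∀ k : Fin l.length, l.get k ∈ N := fun k =>
    Multiset.mem_toFinset.mp ((hmem _).mp (l.get_mem k))
  let c : ∀ k : Fin (l.map N.count).length, Fin l.length := Fin.cast (List.length_map _)
  refine ⟨l.map N.count, fun k => (ab (l.get (c k))).1, fun k => (ab (l.get (c k))).2,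
    ?_, ?_, ?_, fun k => hb _ (hlN _), ?_⟩
  · intro i hi
    obtain ⟨q, hql, rfl⟩ := List.mem_map.mp hi
    exact Multiset.count_pos.mpr (Multiset.mem_toFinset.mp ((hmem q).mp hql))
  · rw [List.pairwise_map]; exact hsort
  · have h1 : ∀ k, ((X - C (ab (l.get (c k))).1) ^ 2 + C (ab (l.get (c k))).2 ^ 2 : R[X]) =
        l.get (c k) := fun k => (hq _ (hlN _)).symm
    simp only [h1]
    rw [prod_fin_map l N.count fun q n => q ^ n, ← List.prod_toFinset _ hnd,
      show l.toFinset = N.toFinset by ext q; rw [List.mem_toFinset, hmem],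
      ← Finset.prod_multiset_count, hN]
  · intro k k' hkk h0
    -- Over an ordered field a zero resultant forces the two quadratics to coincide, whereas the
    -- list of factors has no repetition.
    have h1 := quadratic_eq_of_quadRes_eq_zero h0
    rw [← hq _ (hlN _), ← hq _ (hlN _)] at h1
    have h2 := (List.nodup_iff_injective_get.mp hnd) h1
    exact hkk.ne ((Fin.cast_injective _) h2)

theorem exists_thSystem {F : R[X]} {p : ℕ} (hF : F.Monic) (hd : F.natDegree = p) (hp : 1 ≤ p) :
    ∃ (μ ν : List ℕ) (η : List (DerSign p)),
      (∃ m n : ℕ, μ ∈ Lam m ∧ ν ∈ Lam n ∧ m + 2 * n = p) ∧ η.length = μ.length ∧ η.Nodup ∧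
      η.Pairwise ThomMuLT ∧ ∃ (θ : Fin μ.length → R) (α β : Fin ν.length → R),
        ThSystem F μ ν η θ α β := by
  classical
  obtain ⟨G, hFG, -, hGr⟩ := exists_prod_multiset_X_sub_C_mul F
  have hprodm : (F.roots.map fun a => X - C a).prod.Monic :=
    monic_multiset_prod_of_monic _ _ fun a _ => monic_X_sub_C a
  have hG : G.Monic := hprodm.of_mul_monic_left (hFG.symm ▸ hF)
  obtain ⟨ν, α, β, hν1, hν2, hGν, hβ, hres⟩ := exists_quadratic_factors hG fun x hx => by
    have := (mem_roots hG.ne_zero).mpr hx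
    rw [hGr] at this; exact Multiset.notMem_zero x this
  -- Decreasing multiplicity, then increasing root: by Thom's lemma this is the order of the
  -- encodings.
  obtain ⟨l, hnd, hmem, hsort⟩ := exists_sorted_list F.roots.toFinset
    fun x => toLex (OrderDual.toDual (F.roots.count x), x)
  have hroot : ∀ x ∈ l, F.IsRoot x := fun x hx =>
    isRoot_of_mem_roots (Multiset.mem_toFinset.mp ((hmem x).mp hx))
  have hmu : ∀ x ∈ l, (thomEncoding p F x).mu = F.roots.count x := fun x hx => by
    rw [count_roots]
    exact DerSign.mu_eq_rootMultiplicity hp hd (hroot x hx) _ fun h => sign_eq_zero_iff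
  have hpair : (l.map (thomEncoding p F)).Pairwise ThomMuLT := by
    rw [List.pairwise_map]
    refine (hsort.and hnd).imp_of_mem fun {x y} hx hy h => ?_
    obtain ⟨h1, h2⟩ := h
    rw [ThomMuLT, hmu x hx, hmu y hy]
    rcases Prod.Lex.le_iff.mp h1 with h1 | ⟨h1, h3⟩
    · exact .inl h1
    · exact .inr ⟨h1, thomLT_thomEncoding hp hF hd (hroot x hx) (hroot y hy)
        (lt_of_le_of_ne h3 h2)⟩
  have hfact : FactSystem F (l.map F.roots.count) ν
      (fun j => l.get (Fin.cast (List.length_map _) j)) α β := by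
    refine ⟨?_, ?_, hβ, hres⟩
    · rw [prod_fin_map l F.roots.count fun x n => (X - C x) ^ n, ← List.prod_toFinset _ hnd,
        show l.toFinset = F.roots.toFinset by ext x; rw [List.mem_toFinset, hmem],
        ← Finset.prod_multiset_map_count, ← hGν, hFG]
    · intro j j' hj h0
      exact hj.ne (Fin.cast_injective _ (List.nodup_iff_injective_get.mp hnd h0))
  refine ⟨l.map F.roots.count, ν, l.map (thomEncoding p F), ⟨_, _, ⟨?_, ?_, rfl⟩,
    ⟨hν1, hν2, rfl⟩, hfact.natDegree_eq.symm.trans hd⟩, by simp, ?_, hpair, _, α, β, hfact,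
    by simp, ?_⟩
  · intro i hi
    obtain ⟨x, hx, rfl⟩ := List.mem_map.mp hi
    exact Multiset.count_pos.mpr (Multiset.mem_toFinset.mp ((hmem x).mp hx))
  · rw [List.pairwise_map]
    refine hsort.imp fun {x y} h => ?_
    rcases Prod.Lex.le_iff.mp h with h | ⟨h, -⟩
    · exact (OrderDual.toDual_lt_toDual.mp h).le
    · exact (OrderDual.toDual_inj.mp h).ge
  · exact hpair.imp fun {a b} h => by rintro rfl; exact h.asymm hp h
  · intro j h
    simp [thomEncoding]

end Factorization

/-! ### Roots in R(i): rank and signature of the Hermite form. -/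

section Complexification

theorem sum_sign_eq_card_sub_card {R ι : Type*} [Field R] [LinearOrder R] [Fintype ι] (w : ι → R) :
    ∑ i, (SignType.sign (w i) : ℤ) =
      (Finset.univ.filter fun i => 0 < w i).card - (Finset.univ.filter fun i => w i < 0).card := by
  rw [Finset.card_filter, Finset.card_filter, Nat.cast_sum, Nat.cast_sum,
    ← Finset.sum_sub_distrib]
  refine Finset.sum_congr rfl fun i _ => ?_
  rcases lt_trichotomy (w i) 0 with h | h | h
  · simp [h, h.not_gt]
  · simp [h]
  · simp [h, h.not_gt]

/-- The quadratic extension `R(i)` of an ordered field `R`. -/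
abbrev Cplx (R : Type*) [Field R] : Type _ := QuadraticAlgebra R (-1) 0

instance fact_sq_ne_neg_one {R : Type*} [Field R] [LinearOrder R] [IsStrictOrderedRing R] :
    Fact (∀ r : R, r ^ 2 ≠ -1 + 0 * r) :=
  ⟨fun r h => by nlinarith [sq_nonneg r]⟩

variable {R : Type*} [Field R] [LinearOrder R] [IsStrictOrderedRing R]

theorem Cplx.exists_sq_eq [IsRealClosed R] (z : Cplx R) : ∃ s : Cplx R, s * s = z := by
  obtain ⟨c, d, h1, h2⟩ := exists_complex_sqrt z.re z.im
  refine ⟨⟨c, d⟩, QuadraticAlgebra.ext ?_ ?_⟩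
  · rw [QuadraticAlgebra.re_mul, ← h1]; ring
  · rw [QuadraticAlgebra.im_mul, ← h2]; ring

theorem Cplx.eval_map_star (A : R[X]) (z : Cplx R) :
    (A.map (algebraMap R (Cplx R))).eval (star z) =
      star ((A.map (algebraMap R (Cplx R))).eval z) := by
  rw [eval_map, eval_map]
  have := hom_eval₂ A (algebraMap R (Cplx R)) (starRingEnd (Cplx R)) z
  rw [starRingEnd_apply, starRingEnd_apply] at this
  rw [this]
  congr 1
  refine RingHom.ext fun r => ?_
  refine QuadraticAlgebra.ext ?_ ?_ <;> simp [starRingEnd_apply]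

theorem Cplx.re_sum {R κ : Type*} [Field R] (s : Finset κ) (g : κ → Cplx R) :
    (∑ i ∈ s, g i).re = ∑ i ∈ s, (g i).re :=
  map_sum (QuadraticAlgebra.reₗ (R := R) (-1) 0) g s

variable {μ ν : List ℕ}

/-- The roots in `R(i)` of the polynomial described by a factorization system. -/
def complexRoot (θ : Fin μ.length → R) (α β : Fin ν.length → R) :
    Fin μ.length ⊕ (Fin ν.length ⊕ Fin ν.length) → Cplx R
  | .inl j => algebraMap R (Cplx R) (θ j)
  | .inr (.inl k) => ⟨α k, β k⟩
  | .inr (.inr k) => ⟨α k, -β k⟩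

/-- The multiplicities of the complex roots of a factorization system. -/
def complexMult (μ ν : List ℕ) : Fin μ.length ⊕ (Fin ν.length ⊕ Fin ν.length) → ℕ :=
  Sum.elim μ.get (Sum.elim ν.get ν.get)

variable {F : R[X]} {θ : Fin μ.length → R} {α β : Fin ν.length → R}

theorem FactSystem.map_eq_prod (h : FactSystem F μ ν θ α β) :
    F.map (algebraMap R (Cplx R)) =
      ∏ i, (X - C (complexRoot θ α β i)) ^ complexMult μ ν i := by
  rw [Fintype.prod_sum_type, Fintype.prod_sum_type, ← Finset.prod_mul_distrib]
  conv_lhs => rw [h.eq_prod]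
  rw [Polynomial.map_mul, Polynomial.map_prod, Polynomial.map_prod]
  congr 1
  · refine Finset.prod_congr rfl fun j _ => ?_
    rw [Polynomial.map_pow, Polynomial.map_sub, map_X, map_C]; rfl
  · refine Finset.prod_congr rfl fun k _ => ?_
    rw [Polynomial.map_pow]
    change _ = (X - C (⟨α k, β k⟩ : Cplx R)) ^ ν.get k * (X - C (⟨α k, -β k⟩ : Cplx R)) ^ ν.get k
    rw [← mul_pow]
    congr 1
    rw [Polynomial.map_add, Polynomial.map_pow, Polynomial.map_pow, Polynomial.map_sub, map_X,
      map_C, map_C]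
    have h1 : (⟨α k, β k⟩ : Cplx R) + ⟨α k, -β k⟩ = 2 * algebraMap R (Cplx R) (α k) := by
      refine QuadraticAlgebra.ext ?_ ?_ <;> simp [two_mul]
    have h2 : (⟨α k, β k⟩ : Cplx R) * ⟨α k, -β k⟩ =
        algebraMap R (Cplx R) (α k) ^ 2 + algebraMap R (Cplx R) (β k) ^ 2 := by
      refine QuadraticAlgebra.ext (by simp [sq]) ?_
      simp only [sq, QuadraticAlgebra.im_mul, QuadraticAlgebra.im_add,
        QuadraticAlgebra.algebraMap_re, QuadraticAlgebra.algebraMap_im]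
      ring
    have h1' := congr_arg C h1
    have h2' := congr_arg C h2
    simp only [C_add, C_mul, C_pow, C_ofNat] at h1' h2'
    linear_combination X * h1' - h2'

theorem FactSystem.complexRoot_injective (h : FactSystem F μ ν θ α β) :
    Function.Injective (complexRoot θ α β) := by
  have hθ : Function.Injective θ := fun j j' hj => by
    rcases lt_trichotomy j j' with hl | hl | hl
    · exact absurd hj (h.real_ne _ _ hl)
    · exact hl
    · exact absurd hj.symm (h.real_ne _ _ hl)
  have hαβ : ∀ k k', α k = α k' → (β k = β k' ∨ β k = -β k') → k = k' := by
    intro k k' h1 h2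
    have h3 : quadRes (α k) (β k) (α k') (β k') = 0 ∧ quadRes (α k') (β k') (α k) (β k) = 0 := by
      rcases h2 with h2 | h2 <;> constructor <;> simp [quadRes, h1, h2]
    rcases lt_trichotomy k k' with hl | hl | hl
    · exact absurd h3.1 (h.res_ne _ _ hl)
    · exact hl
    · exact absurd h3.2 (h.res_ne _ _ hl)
  have hβ := h.im_ne
  rintro (j | k | k) (j' | k' | k') hjk <;>
    have h1 := congr_arg QuadraticAlgebra.re hjk <;>
    have h2 := congr_arg QuadraticAlgebra.im hjk <;>
    simp only [complexRoot, QuadraticAlgebra.algebraMap_re, QuadraticAlgebra.algebraMap_im]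
      at h1 h2
  · rw [hθ h1]
  · exact absurd h2.symm (hβ k')
  · exact absurd (neg_eq_zero.mp h2.symm) (hβ k')
  · exact absurd h2 (hβ k)
  · rw [hαβ k k' h1 (.inl h2)]
  · obtain rfl := hαβ k k' h1 (.inr h2)
    exact absurd (self_eq_neg.mp h2) (hβ k)
  · exact absurd (neg_eq_zero.mp h2) (hβ k)
  · obtain rfl := hαβ k k' h1 (.inr (by rw [← h2, neg_neg]))
    exact absurd (neg_eq_self.mp h2) (hβ k)
  · rw [hαβ k k' h1 (.inl (neg_inj.mp h2))]

theorem rootMultiplicity_prod_pow {K ι : Type*} [Field K] [Fintype ι] {ρ : ι → K}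
    (hρ : Function.Injective ρ) (m : ι → ℕ) (i : ι) :
    rootMultiplicity (ρ i) (∏ k, (X - C (ρ k)) ^ m k) = m i := by
  classical
  rw [← count_roots, roots_prod _ _ (Finset.prod_ne_zero_iff.mpr fun k _ =>
    pow_ne_zero _ (X_sub_C_ne_zero _)), Multiset.count_bind]
  simp only [roots_pow, roots_X_sub_C, Multiset.count_nsmul, Multiset.count_singleton]
  change ∑ k, _ = _
  simp [hρ.eq_iff]

theorem complexMult_pos (hμ : ∀ i ∈ μ, 1 ≤ i) (hν : ∀ i ∈ ν, 1 ≤ i) (i) :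
    1 ≤ complexMult μ ν i := by
  rcases i with j | k | k
  · exact hμ _ (μ.get_mem j)
  · exact hν _ (ν.get_mem k)
  · exact hν _ (ν.get_mem k)

/-- The functional `f ↦ Tr(A f)` on `R[X]`, for the trace of `R[X] / (F)`. -/
noncomputable def traceFunctional {S : Type*} [CommRing S] (F A : S[X]) : S[X] →ₗ[S] S :=
  Algebra.trace S (AdjoinRoot F) ∘ₗ (AdjoinRoot.mkₐ F).toLinearMap ∘ₗ LinearMap.mulLeft S A

theorem traceFunctional_apply {S : Type*} [CommRing S] (F A f : S[X]) :
    traceFunctional F A f = Algebra.trace S (AdjoinRoot F) (AdjoinRoot.mk F (A * f)) := rfl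

theorem FactSystem.algebraMap_traceFunctional (h : FactSystem F μ ν θ α β) (hF : F.Monic)
    (A f : R[X]) : algebraMap R (Cplx R) (traceFunctional F A f) =
      ∑ i, complexMult μ ν i * ((A.map (algebraMap R (Cplx R))).eval (complexRoot θ α β i) *
        (f.map (algebraMap R (Cplx R))).eval (complexRoot θ α β i)) := by
  rw [traceFunctional_apply, map_trace_mk _ hF, trace_mk_prod_pow _ _ h.map_eq_prod]
  simp only [Polynomial.map_mul, eval_mul]

theorem FactSystem.algebraMap_hankelMinor (h : FactSystem F μ ν θ α β) (hF : F.Monic)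
    (A : R[X]) (n : ℕ) : algebraMap R (Cplx R) (hankelMinor (traceFunctional F A) n) =
      (Matrix.of fun i j : Fin n => ∑ k, (complexMult μ ν k *
        (A.map (algebraMap R (Cplx R))).eval (complexRoot θ α β k)) *
          complexRoot θ α β k ^ ((i : ℕ) + (j : ℕ))).det := by
  rw [hankelMinor, RingHom.map_det]
  congr 1
  ext1 i j
  rw [RingHom.mapMatrix_apply, Matrix.map_apply, Matrix.of_apply, Matrix.of_apply,
    h.algebraMap_traceFunctional hF]
  refine Finset.sum_congr rfl fun k _ => ?_
  rw [Polynomial.map_pow, map_X, eval_pow, eval_X, mul_assoc]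

open Classical in
/-- The number of complex roots at which `A` does not vanish. -/
noncomputable def nonvanishingCount (θ : Fin μ.length → R) (α β : Fin ν.length → R) (A : R[X]) :
    ℕ :=
  (Finset.univ.filter fun i =>
    (A.map (algebraMap R (Cplx R))).eval (complexRoot θ α β i) ≠ 0).card

theorem card_filter_mult_mul_ne_zero [DecidableEq (Cplx R)] (hμ : ∀ i ∈ μ, 1 ≤ i)
    (hν : ∀ i ∈ ν, 1 ≤ i) (A : R[X]) :
    (Finset.univ.filter fun i => (complexMult μ ν i : Cplx R) *
      (A.map (algebraMap R (Cplx R))).eval (complexRoot θ α β i) ≠ 0).card =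
        nonvanishingCount θ α β A := by
  rw [nonvanishingCount]
  congr 1
  ext i
  have : (complexMult μ ν i : Cplx R) ≠ 0 :=
    Nat.cast_ne_zero.mpr (Nat.one_le_iff_ne_zero.mp (complexMult_pos hμ hν i))
  simp only [Finset.mem_filter, Finset.mem_univ, true_and, ne_eq, mul_eq_zero, this, false_or]

theorem FactSystem.hankelMinor_eq_zero (h : FactSystem F μ ν θ α β) (hF : F.Monic)
    (hμ : ∀ i ∈ μ, 1 ≤ i) (hν : ∀ i ∈ ν, 1 ≤ i) {A : R[X]} {n : ℕ}
    (hn : nonvanishingCount θ α β A < n) : hankelMinor (traceFunctional F A) n = 0 := by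
  classical
  refine (algebraMap R (Cplx R)).injective ?_
  rw [h.algebraMap_hankelMinor hF, map_zero]
  refine det_sum_mul_pow_eq_zero _ _ ?_
  rwa [card_filter_mult_mul_ne_zero hμ hν]

theorem FactSystem.hankelMinor_ne_zero (h : FactSystem F μ ν θ α β) (hF : F.Monic)
    (hμ : ∀ i ∈ μ, 1 ≤ i) (hν : ∀ i ∈ ν, 1 ≤ i) (A : R[X]) :
    hankelMinor (traceFunctional F A) (nonvanishingCount θ α β A) ≠ 0 := by
  classical
  intro h0
  have := congr_arg (algebraMap R (Cplx R)) h0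
  rw [h.algebraMap_hankelMinor hF, map_zero] at this
  exact det_sum_mul_pow_ne_zero _ _ h.complexRoot_injective
    (card_filter_mult_mul_ne_zero hμ hν A) this

/-- With s² = A(z), a conjugate pair contributes 2ν Re((s f(z))²) = 2ν (Re² - Im²) of s f(z): one
positive and one negative square. Only the real roots are left in the signature. -/
theorem FactSystem.exists_diagonalization [IsRealClosed R] (h : FactSystem F μ ν θ α β)
    (hF : F.Monic) (hμ : ∀ i ∈ μ, 1 ≤ i) (hν : ∀ i ∈ ν, 1 ≤ i) (A : R[X]) :
    ∃ (w : Fin μ.length ⊕ (Fin ν.length ⊕ Fin ν.length) → R)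
      (l : Fin μ.length ⊕ (Fin ν.length ⊕ Fin ν.length) → R[X] →ₗ[R] R),
      (∀ f, traceFunctional F A (f * f) = ∑ i, w i * l i f ^ 2) ∧
      (∀ f ∈ degreeLT R (nonvanishingCount θ α β A), (∀ i, w i ≠ 0 → l i f = 0) → f = 0) ∧
      (Finset.univ.filter fun i => w i ≠ 0).card = nonvanishingCount θ α β A ∧
      ∑ i, (SignType.sign (w i) : ℤ) = ∑ j, (SignType.sign (A.eval (θ j)) : ℤ) := by
  classical
  let ev : R[X] → Cplx R → Cplx R := fun f z => (f.map (algebraMap R (Cplx R))).eval z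
  let z : Fin ν.length → Cplx R := fun k => ⟨α k, β k⟩
  have hconj : ∀ f k, ev f ⟨α k, -β k⟩ = star (ev f (z k)) := by
    intro f k
    rw [← Cplx.eval_map_star]
    simp [ev, z, QuadraticAlgebra.star_mk]
  have hreal : ∀ f j, ev f (algebraMap R (Cplx R) (θ j)) = algebraMap R (Cplx R) (f.eval (θ j)) :=
    fun f j => eval_map_apply _ _
  choose s hs using fun k => Cplx.exists_sq_eq (ev A (z k))
  let evₗ : Cplx R → R[X] →ₗ[R] Cplx R := fun x => (aeval x).toLinearMap
  have hevₗ : ∀ f x, evₗ x f = ev f x := fun f x => (eval_map_algebraMap f x).symm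
  -- The weight is set to 0 when A(z) = 0, so that nonzero weights correspond exactly to the roots
  -- where A does not vanish.
  let c : Fin ν.length → R := fun k => if ev A (z k) = 0 then 0 else 2 * ν.get k
  let w : Fin μ.length ⊕ (Fin ν.length ⊕ Fin ν.length) → R :=
    Sum.elim (fun j => μ.get j * A.eval (θ j)) (Sum.elim c fun k => -c k)
  let l : Fin μ.length ⊕ (Fin ν.length ⊕ Fin ν.length) → R[X] →ₗ[R] R :=
    Sum.elim (fun j => leval (θ j))
      (Sum.elim (fun k => QuadraticAlgebra.reₗ (-1) 0 ∘ₗ LinearMap.mulLeft R (s k) ∘ₗ evₗ (z k))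
        fun k => QuadraticAlgebra.imₗ (-1) 0 ∘ₗ LinearMap.mulLeft R (s k) ∘ₗ evₗ (z k))
  have hl1 : ∀ k f, l (.inr (.inl k)) f = (s k * ev f (z k)).re := fun k f => by
    rw [← hevₗ]; rfl
  have hl2 : ∀ k f, l (.inr (.inr k)) f = (s k * ev f (z k)).im := fun k f => by
    rw [← hevₗ]; rfl
  have hν0 : ∀ k, (ν.get k : R) ≠ 0 := fun k =>
    Nat.cast_ne_zero.mpr (Nat.one_le_iff_ne_zero.mp (hν _ (ν.get_mem k)))
  have hμ0 : ∀ j, (0 : R) < μ.get j := fun j => Nat.cast_pos.mpr (hμ _ (μ.get_mem j))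
  have hc : ∀ k, c k ≠ 0 ↔ ev A (z k) ≠ 0 := fun k => by
    by_cases h0 : ev A (z k) = 0 <;> simp [c, h0]
    exact (Nat.one_le_iff_ne_zero.mp (hν _ (ν.get_mem k)))
  have hw : ∀ i, w i ≠ 0 ↔ ev A (complexRoot θ α β i) ≠ 0 := by
    rintro (j | k | k)
    · change _ * _ ≠ 0 ↔ ev A (algebraMap R (Cplx R) (θ j)) ≠ 0
      rw [hreal, mul_ne_zero_iff, and_iff_right (hμ0 j).ne', Ne, Ne,
        FaithfulSMul.algebraMap_eq_zero_iff]
    · exact hc k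
    · change -c k ≠ 0 ↔ ev A ⟨α k, -β k⟩ ≠ 0
      rw [hconj, neg_ne_zero, hc, Ne, Ne, star_eq_zero]
  have hcard : (Finset.univ.filter fun i => w i ≠ 0).card = nonvanishingCount θ α β A := by
    rw [nonvanishingCount]
    congr 1
    ext i
    simp only [Finset.mem_filter, Finset.mem_univ, true_and]
    exact hw i
  refine ⟨w, l, fun f => ?_, fun f hf hlf => ?_, hcard, ?_⟩
  · have h1 := congr_arg QuadraticAlgebra.re (h.algebraMap_traceFunctional hF A (f * f))
    rw [QuadraticAlgebra.algebraMap_re] at h1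
    rw [h1, Fintype.sum_sum_type, Fintype.sum_sum_type, Fintype.sum_sum_type,
      Fintype.sum_sum_type, ← Finset.sum_add_distrib, ← Finset.sum_add_distrib]
    rw [QuadraticAlgebra.re_add, Cplx.re_sum, Cplx.re_sum]
    congr 1
    · refine Finset.sum_congr rfl fun j _ => ?_
      change ((μ.get j : Cplx R) * (ev A (algebraMap R (Cplx R) (θ j)) *
        ev (f * f) (algebraMap R (Cplx R) (θ j)))).re = μ.get j * A.eval (θ j) * f.eval (θ j) ^ 2
      rw [hreal, hreal, ← map_mul, ← map_natCast (algebraMap R (Cplx R)), ← map_mul,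
        QuadraticAlgebra.algebraMap_re, eval_mul]
      ring
    · refine Finset.sum_congr rfl fun k _ => ?_
      change ((ν.get k : Cplx R) * (ev A (z k) * ev (f * f) (z k)) +
        (ν.get k : Cplx R) * (ev A ⟨α k, -β k⟩ * ev (f * f) ⟨α k, -β k⟩)).re =
          c k * l (.inr (.inl k)) f ^ 2 + -c k * l (.inr (.inr k)) f ^ 2
      have hff : ev (f * f) (z k) = ev f (z k) * ev f (z k) := by
        simp only [ev, Polynomial.map_mul, eval_mul]
      have hsq : ev A (z k) * (ev f (z k) * ev f (z k)) =
          (s k * ev f (z k)) * (s k * ev f (z k)) := by rw [← hs]; ring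
      rw [hconj, hconj, hff, ← mul_add, ← star_mul', hsq, hl1, hl2,
        ← map_natCast (algebraMap R (Cplx R))]
      by_cases h0 : ev A (z k) = 0
      · have hs0 : s k = 0 := mul_self_eq_zero.mp ((hs k).trans h0)
        simp [c, h0, hs0]
      · simp only [c, if_neg h0]
        simp
        ring
  · have hz : f.map (algebraMap R (Cplx R)) = 0 := by
      -- f vanishes at more distinct points of R(i) than its degree allows.
      refine eq_zero_of_degree_lt_of_eval_index_eq_zero
        (Finset.univ.filter fun i => w i ≠ 0) (v := complexRoot θ α β)
        h.complexRoot_injective.injOn ?_ ?_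
      · rw [degree_map, hcard]; exact mem_degreeLT.mp hf
      · have hz0 : ∀ k, c k ≠ 0 → ev f (z k) = 0 := by
          intro k hk
          have h1 := hlf (.inr (.inl k)) hk
          have h2 := hlf (.inr (.inr k)) (neg_ne_zero.mpr hk)
          rw [hl1] at h1
          rw [hl2] at h2
          have h3 : s k * ev f (z k) = 0 := QuadraticAlgebra.ext h1 h2
          refine (mul_eq_zero.mp h3).resolve_left fun h4 => (hc k).mp hk ?_
          rw [← hs, h4, zero_mul]
        rintro (j | k | k) hi <;> have hi := (Finset.mem_filter.mp hi).2
        · have := hlf _ hi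
          change ev f (algebraMap R (Cplx R) (θ j)) = 0
          rw [hreal]
          change f.eval (θ j) = 0 at this
          rw [this, map_zero]
        · exact hz0 k hi
        · change ev f ⟨α k, -β k⟩ = 0
          rw [hconj, hz0 k (neg_ne_zero.mp hi), star_zero]
    exact (Polynomial.map_eq_zero _).mp hz
  · rw [Fintype.sum_sum_type, Fintype.sum_sum_type, ← Finset.sum_add_distrib]
    have h1 : ∀ k, (SignType.sign (w (.inr (.inl k))) : ℤ) +
        (SignType.sign (w (.inr (.inr k))) : ℤ) = 0 := by
      intro k
      change (SignType.sign (c k) : ℤ) + (SignType.sign (-c k) : ℤ) = 0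
      rw [Left.sign_neg]
      cases SignType.sign (c k) <;> decide
    rw [Finset.sum_eq_zero fun k _ => h1 k, add_zero]
    refine Finset.sum_congr rfl fun j _ => ?_
    change (SignType.sign ((μ.get j : R) * A.eval (θ j)) : ℤ) = _
    rw [sign_mul, sign_pos (hμ0 j), one_mul]

end Complexification

/-! ### The signs of the minors determine (μ, ν, η). -/

section Comparison

variable {R : Type*} [Field R] [LinearOrder R]

/-- The data `(μ, ν, η)` attached to `F` by a system `Th(F)^{μ, ν, η}`, with `η` sorted. -/
def IsThomData {p : ℕ} (F : R[X]) (μ ν : List ℕ) (η : List (DerSign p)) : Prop :=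
  (∃ m n : ℕ, μ ∈ Lam m ∧ ν ∈ Lam n ∧ m + 2 * n = p) ∧ η.length = μ.length ∧ η.Nodup ∧
    η.Pairwise ThomMuLT ∧ ∃ (θ : Fin μ.length → R) (α β : Fin ν.length → R),
      ThSystem F μ ν η θ α β

theorem univ_val_map_get {A : Type*} (l : List A) :
    (Finset.univ : Finset (Fin l.length)).val.map l.get = (l : Multiset A) := by
  rw [Fin.univ_val_map, List.ofFn_get]

theorem ThSystem.get_eq_thomEncoding {p : ℕ} {F : R[X]} {μ ν : List ℕ} {η : List (DerSign p)}
    {θ : Fin μ.length → R} {α β : Fin ν.length → R} (h : ThSystem F μ ν η θ α β)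
    (j : Fin μ.length) : η.get (Fin.cast h.length_eq j) = thomEncoding p F (θ j) :=
  funext fun i => (h.sign_eq j i).symm

theorem ThSystem.coe_eq_map {p : ℕ} {F : R[X]} {μ ν : List ℕ} {η : List (DerSign p)}
    {θ : Fin μ.length → R} {α β : Fin ν.length → R} (h : ThSystem F μ ν η θ α β) :
    (η : Multiset (DerSign p)) =
      (Finset.univ : Finset (Fin μ.length)).val.map fun j => thomEncoding p F (θ j) := by
  rw [← univ_val_map_get, ← Finset.univ_map_equiv_to_embedding (finCongr h.length_eq),
    Finset.map_val, Multiset.map_map]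
  exact Multiset.map_congr rfl fun j _ => h.get_eq_thomEncoding j

variable [IsStrictOrderedRing R]

theorem length_le_sum_of_forall_one_le {l : List ℕ} (h : ∀ i ∈ l, 1 ≤ i) :
    l.length ≤ l.sum := by
  simpa using List.card_nsmul_le_sum l 1 h

theorem nonvanishingCount_le {μ ν : List ℕ} (hμ : ∀ i ∈ μ, 1 ≤ i) (hν : ∀ i ∈ ν, 1 ≤ i)
    (θ : Fin μ.length → R) (α β : Fin ν.length → R) (A : R[X]) :
    nonvanishingCount θ α β A ≤ μ.sum + 2 * ν.sum := by
  refine (Finset.card_le_univ _).trans ?_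
  rw [Fintype.card_sum, Fintype.card_sum, Fintype.card_fin, Fintype.card_fin]
  have := length_le_sum_of_forall_one_le hμ
  have := length_le_sum_of_forall_one_le hν
  omega

/-- The product `∏ (F^(h)) ^ α_h` over `1 ≤ h ≤ p - 1`. -/
noncomputable def derProd {S : Type*} [CommRing S] (p : ℕ) (F : S[X])
    (a : Finset.Icc 1 (p - 1) → Fin 3) : S[X] :=
  ∏ h : Finset.Icc 1 (p - 1), (derivative^[(h : ℕ)] F) ^ (a h : ℕ)

theorem map_derProd {S T : Type*} [CommRing S] [CommRing T] (φ : S →+* T) (p : ℕ) (F : S[X])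
    (a : Finset.Icc 1 (p - 1) → Fin 3) : (derProd p F a).map φ = derProd p (F.map φ) a := by
  simp only [derProd, Polynomial.map_prod, Polynomial.map_pow, iterate_derivative_map]

theorem prod_thomEncoding_pow {p : ℕ} (F : R[X]) (x : R)
    (a : Finset.Icc 1 (p - 1) → Fin 3) :
    ∏ h, (thomEncoding p F x h : ℤ) ^ (a h : ℕ) = (SignType.sign ((derProd p F a).eval x) : ℤ) := by
  have h1 : (SignType.sign ((derProd p F a).eval x) : SignType) =
      ∏ h, thomEncoding p F x h ^ (a h : ℕ) := by
    simp only [derProd, eval_prod, eval_pow, ← signHom_apply, map_prod, map_pow, thomEncoding]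
  rw [h1]
  change _ = (SignType.castHom (_ : SignType) : ℤ)
  rw [map_prod]
  simp only [map_pow, SignType.castHom_apply]

open Classical in
/-- The vanishing pattern of the derivatives of `G` at `z`: value `0` at the orders of the
derivatives vanishing at `z`, and `1` at the others. -/
noncomputable def vanishingPattern {K : Type*} [Field K] (p : ℕ) (G : K[X]) (z : K) : DerSign p :=
  fun h => if (derivative^[(h : ℕ)] G).IsRoot z then 0 else 1

theorem vanishingPattern_eq_zero_iff {K : Type*} [Field K] {p : ℕ} (G : K[X]) (z : K)
    (h : Finset.Icc 1 (p - 1)) :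
    vanishingPattern p G z h = 0 ↔ (derivative^[(h : ℕ)] G).IsRoot z := by
  rw [vanishingPattern]; split_ifs with h0 <;> simpa using h0

theorem prod_vanishingPattern_pow {K : Type*} [Field K] [DecidableEq K] {p : ℕ} (G : K[X]) (z : K)
    (a : Finset.Icc 1 (p - 1) → Fin 3) :
    ∏ h, (vanishingPattern p G z h : ℤ) ^ (a h : ℕ) =
      if (derProd p G a).eval z ≠ 0 then 1 else 0 := by
  have h1 : ∀ h, (vanishingPattern p G z h : ℤ) ^ (a h : ℕ) =
      if ((derivative^[(h : ℕ)] G) ^ (a h : ℕ)).eval z ≠ 0 then 1 else 0 := by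
    intro h
    by_cases h0 : (derivative^[(h : ℕ)] G).IsRoot z
    · rw [vanishingPattern, if_pos h0, eval_pow, h0.eq_zero]
      by_cases ha : (a h : ℕ) = 0 <;> simp [ha]
    · rw [vanishingPattern, if_neg h0, eval_pow, if_pos (pow_ne_zero _ h0)]
      simp
  rw [Finset.prod_congr rfl fun h _ => h1 h, derProd, eval_prod]
  by_cases h0 : ∏ h : Finset.Icc 1 (p - 1), ((derivative^[(h : ℕ)] G) ^ (a h : ℕ)).eval z = 0
  · obtain ⟨h, hh, hz⟩ := Finset.prod_eq_zero_iff.mp h0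
    rw [if_neg (not_not.mpr h0)]
    exact Finset.prod_eq_zero hh (if_neg (not_not.mpr hz))
  · rw [if_pos h0]
    exact Finset.prod_eq_one fun h hh => if_pos (Finset.prod_ne_zero_iff.mp h0 h hh)

theorem univ_val_map_sumElim {A B M : Type*} [Fintype A] [Fintype B] (f : A ⊕ B → M) :
    (Finset.univ : Finset (A ⊕ B)).val.map f =
      (Finset.univ : Finset A).val.map (f ∘ Sum.inl) +
        (Finset.univ : Finset B).val.map (f ∘ Sum.inr) := by
  rw [← Finset.univ_disjSum_univ, Finset.val_disjSum, Multiset.disjSum, Multiset.map_add,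
    Multiset.map_map, Multiset.map_map]

theorem FactSystem.rootMultiplicity_complexRoot {F : R[X]} {μ ν : List ℕ}
    {θ : Fin μ.length → R} {α β : Fin ν.length → R} (h : FactSystem F μ ν θ α β) (i) :
    rootMultiplicity (complexRoot θ α β i) (F.map (algebraMap R (Cplx R))) =
      complexMult μ ν i := by
  rw [h.map_eq_prod, rootMultiplicity_prod_pow h.complexRoot_injective]

theorem FactSystem.mu_eq_complexMult {p : ℕ} (hp : 1 ≤ p) {F : R[X]} (hF : F.Monic)
    (hd : F.natDegree = p) {μ ν : List ℕ} (hμ : ∀ i ∈ μ, 1 ≤ i) (hν : ∀ i ∈ ν, 1 ≤ i)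
    {θ : Fin μ.length → R} {α β : Fin ν.length → R} (h : FactSystem F μ ν θ α β) (i)
    (η : DerSign p) (hη : ∀ k : Finset.Icc 1 (p - 1), η k = 0 ↔
      (derivative^[(k : ℕ)] (F.map (algebraMap R (Cplx R)))).IsRoot (complexRoot θ α β i)) :
    η.mu = complexMult μ ν i := by
  rw [← h.rootMultiplicity_complexRoot i]
  refine DerSign.mu_eq_rootMultiplicity hp (by rw [natDegree_map, hd]) ?_ η hη
  refine (rootMultiplicity_pos (hF.map _).ne_zero).mp ?_
  rw [h.rootMultiplicity_complexRoot i]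
  exact complexMult_pos hμ hν i

theorem ThSystem.eq_map_mu {p : ℕ} (hp : 1 ≤ p) {F : R[X]} (hF : F.Monic)
    (hd : F.natDegree = p) {μ ν : List ℕ} (hμ : ∀ i ∈ μ, 1 ≤ i) (hν : ∀ i ∈ ν, 1 ≤ i)
    {η : List (DerSign p)} {θ : Fin μ.length → R} {α β : Fin ν.length → R}
    (h : ThSystem F μ ν η θ α β) : μ = η.map DerSign.mu := by
  refine List.ext_get (by rw [List.length_map, h.length_eq]) fun n h1 h2 => ?_
  have := h.get_eq_thomEncoding ⟨n, h1⟩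
  rw [List.get_eq_getElem, List.get_eq_getElem, List.getElem_map]
  refine Eq.trans ?_ (congr_arg DerSign.mu this).symm
  refine (h.fact.mu_eq_complexMult hp hF hd hμ hν (.inl ⟨n, h1⟩) _ fun k => ?_).symm
  rw [thomEncoding, sign_eq_zero_iff, IsRoot, iterate_derivative_map]
  change _ ↔ eval (algebraMap R (Cplx R) _) _ = 0
  rw [eval_map_apply, FaithfulSMul.algebraMap_eq_zero_iff]

variable [IsRealClosed R]

/-- The rank is the largest size of a nonzero minor, so it is read off the signs. Inertia at that
common size then compares the signatures. -/
theorem FactSystem.counts_eq {F F' A A' : R[X]} {μ ν μ' ν' : List ℕ} {θ : Fin μ.length → R}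
    {α β : Fin ν.length → R} {θ' : Fin μ'.length → R} {α' β' : Fin ν'.length → R}
    (h : FactSystem F μ ν θ α β) (h' : FactSystem F' μ' ν' θ' α' β') (hF : F.Monic)
    (hF' : F'.Monic) (hμ : ∀ i ∈ μ, 1 ≤ i) (hν : ∀ i ∈ ν, 1 ≤ i) (hμ' : ∀ i ∈ μ', 1 ≤ i)
    (hν' : ∀ i ∈ ν', 1 ≤ i) (hd : F.natDegree = F'.natDegree)
    (hs : ∀ j ≤ F.natDegree, SignType.sign (hankelMinor (traceFunctional F A) j) =
      SignType.sign (hankelMinor (traceFunctional F' A') j)) :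
    nonvanishingCount θ α β A = nonvanishingCount θ' α' β' A' ∧
      ∑ j, (SignType.sign (A.eval (θ j)) : ℤ) = ∑ j, (SignType.sign (A'.eval (θ' j)) : ℤ) := by
  have hr : nonvanishingCount θ α β A ≤ F.natDegree :=
    (nonvanishingCount_le hμ hν θ α β A).trans h.natDegree_eq.ge
  have hr' : nonvanishingCount θ' α' β' A' ≤ F.natDegree :=
    (nonvanishingCount_le hμ' hν' θ' α' β' A').trans (h'.natDegree_eq.ge.trans hd.ge)
  have hzero : ∀ j ≤ F.natDegree, hankelMinor (traceFunctional F A) j = 0 ↔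
      hankelMinor (traceFunctional F' A') j = 0 := fun j hj => by
    rw [← sign_eq_zero_iff, hs j hj, sign_eq_zero_iff]
  have hcount : nonvanishingCount θ α β A = nonvanishingCount θ' α' β' A' := by
    refine le_antisymm ?_ ?_
    · by_contra! hlt
      exact h.hankelMinor_ne_zero hF hμ hν A
        ((hzero _ hr).mpr (h'.hankelMinor_eq_zero hF' hμ' hν' hlt))
    · by_contra! hlt
      exact h'.hankelMinor_ne_zero hF' hμ' hν' A'
        ((hzero _ hr').mp (h.hankelMinor_eq_zero hF hμ hν hlt))
  obtain ⟨w, l, hL, hinj, hw, hsum⟩ := h.exists_diagonalization hF hμ hν A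
  obtain ⟨w', l', hL', hinj', hw', hsum'⟩ := h'.exists_diagonalization hF' hμ' hν' A'
  refine ⟨hcount, ?_⟩
  rw [← hcount] at hinj' hw'
  obtain ⟨h1, h2⟩ := card_pos_eq_of_hankelMinor_sign_eq (fun j hj => hs j (hj.trans hr))
    (h.hankelMinor_ne_zero hF hμ hν A) w l hL hinj hw w' l' hL' hinj' hw'
  rw [← hsum, ← hsum', sum_sign_eq_card_sub_card, sum_sign_eq_card_sub_card, h1, h2]

theorem IsThomData.eq_of_hankelMinor_sign_eq {p : ℕ} (hp : 1 ≤ p) {F F' : R[X]} (hF : F.Monic)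
    (hF' : F'.Monic) (hd : F.natDegree = p) (hd' : F'.natDegree = p) {μ ν μ' ν' : List ℕ}
    {η η' : List (DerSign p)} (h : IsThomData F μ ν η) (h' : IsThomData F' μ' ν' η')
    (hs : ∀ a : Finset.Icc 1 (p - 1) → Fin 3,
      (Finset.univ.filter fun h => a h ≠ 0).card ≤ Nat.size p → ∀ n ≤ p,
        SignType.sign (hankelMinor (traceFunctional F (derProd p F a)) n) =
          SignType.sign (hankelMinor (traceFunctional F' (derProd p F' a)) n)) :
    μ = μ' ∧ ν = ν' ∧ η = η' := by
  classical
  obtain ⟨⟨m, n, ⟨hμ, -, rfl⟩, ⟨hν, hνs, rfl⟩, hmn⟩, -, -, hsort, θ, α, β, hT⟩ := h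
  obtain ⟨⟨m', n', ⟨hμ', -, rfl⟩, ⟨hν', hνs', rfl⟩, hmn'⟩, -, -, hsort', θ', α', β', hT'⟩ := h'
  have hcounts := fun a ha => hT.fact.counts_eq hT'.fact hF hF' hμ hν hμ' hν' (hd.trans hd'.symm)
    (fun j hj => hs a ha j (hj.trans hd.le))
  have hlen : ∀ {μ ν : List ℕ}, (∀ i ∈ μ, 1 ≤ i) → (∀ i ∈ ν, 1 ≤ i) → μ.sum + 2 * ν.sum = p →
      μ.length + (ν.length + ν.length) < 2 ^ Nat.size p := by
    intro μ ν hμ hν hmn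
    have h1 := length_le_sum_of_forall_one_le hμ
    have h2 := length_le_sum_of_forall_one_le hν
    have h3 := Nat.lt_size_self p
    omega
  -- Signatures are the moments of the Thom encodings of the real roots.
  have hη : (η : Multiset (DerSign p)) = η' := by
    refine eq_of_moments_eq (Nat.size p) _ _ ?_ ?_ fun a ha => ?_
    · have := hlen hμ hν hmn
      rw [Multiset.coe_card, ← hT.length_eq]; omega
    · have := hlen hμ' hν' hmn'
      rw [Multiset.coe_card, ← hT'.length_eq]; omega
    · rw [hT.coe_eq_map, hT'.coe_eq_map, Multiset.map_map, Multiset.map_map]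
      simp only [Function.comp_def, prod_thomEncoding_pow]
      exact (hcounts a ha).2
  have hηeq : η = η' := by
    refine List.Perm.eq_of_pairwise (le := ThomMuLT) ?_ hsort hsort' (Multiset.coe_eq_coe.mp hη)
    intro a b _ _ h1 h2
    exact (h1.asymm hp h2).elim
  have hμeq : μ = μ' := by
    rw [hT.eq_map_mu hp hF hd hμ hν, hT'.eq_map_mu hp hF' hd' hμ' hν', hηeq]
  refine ⟨hμeq, ?_, hηeq⟩
  let pat : ∀ {μ ν : List ℕ} (F : R[X]) (θ : Fin μ.length → R) (α β : Fin ν.length → R),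
      Fin μ.length ⊕ (Fin ν.length ⊕ Fin ν.length) → DerSign p := fun F θ α β i =>
    vanishingPattern p (F.map (algebraMap R (Cplx R))) (complexRoot θ α β i)
  -- Ranks are the moments of the 0/1 vanishing patterns, now over all roots in R(i); this reaches
  -- the non-real multiplicities.
  have hpat : Finset.univ.val.map (pat F θ α β) = Finset.univ.val.map (pat F' θ' α' β') := by
    refine eq_of_moments_eq (Nat.size p) _ _ ?_ ?_ fun a ha => ?_
    · simpa using hlen hμ hν hmn
    · simpa using hlen hμ' hν' hmn'
    · have := (hcounts a ha).1
      rw [nonvanishingCount, nonvanishingCount, Finset.card_filter, Finset.card_filter] at this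
      have := congr_arg (Nat.cast : ℕ → ℤ) this
      rw [Nat.cast_sum, Nat.cast_sum] at this
      rw [Multiset.map_map, Multiset.map_map]
      simp only [Function.comp_def, pat, prod_vanishingPattern_pow]
      change ∑ i, _ = ∑ i, _
      simpa only [map_derProd, Nat.cast_ite, Nat.cast_one, Nat.cast_zero] using this
  have hmult := congr_arg (Multiset.map DerSign.mu) hpat
  rw [Multiset.map_map, Multiset.map_map] at hmult
  have e1 : DerSign.mu ∘ pat F θ α β = complexMult μ ν := funext fun i =>
    hT.fact.mu_eq_complexMult hp hF hd hμ hν i _ fun k => vanishingPattern_eq_zero_iff _ _ k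
  have e2 : DerSign.mu ∘ pat F' θ' α' β' = complexMult μ' ν' := funext fun i =>
    hT'.fact.mu_eq_complexMult hp hF' hd' hμ' hν' i _ fun k => vanishingPattern_eq_zero_iff _ _ k
  have e3 : ∀ μ ν : List ℕ, Finset.univ.val.map (complexMult μ ν) =
      (μ : Multiset ℕ) + ((ν : Multiset ℕ) + (ν : Multiset ℕ)) := by
    intro μ ν
    rw [univ_val_map_sumElim, univ_val_map_sumElim]
    simp only [complexMult, Sum.elim_comp_inl, Sum.elim_comp_inr]
    rw [univ_val_map_get, univ_val_map_get]
  rw [e1, e2, e3, e3, hμeq, add_right_inj] at hmult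
  -- Each quadratic factor accounts for two conjugate roots, so ν occurs twice and counts are
  -- halved.
  have hνm : (ν : Multiset ℕ) = ν' := by
    refine Multiset.ext.mpr fun c => ?_
    have := congr_arg (Multiset.count c) hmult
    rw [Multiset.count_add, Multiset.count_add] at this
    omega
  exact List.Perm.eq_of_pairwise (le := (· ≥ ·)) (fun a b _ _ h1 h2 => le_antisymm h2 h1)
    hνs hνs' (Multiset.coe_eq_coe.mp hνm)

end Comparison

/-! ### Substituting u = υ in the elimination family. -/

section Specialization

variable {K R : Type*} [Field K] [Field R] [Algebra K R] {k : ℕ}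

theorem aeval_hermiteMatrix_minor {P : (MvPolynomial (Fin k) K)[X]} (hP : P.Monic)
    (A : (MvPolynomial (Fin k) K)[X]) (υ : Fin k → R) {n : ℕ} (hn : n ≤ P.natDegree) :
    MvPolynomial.aeval υ
      ((hermiteMatrix P A).submatrix (Fin.castLE hn) (Fin.castLE hn)).det =
        hankelMinor (traceFunctional (specialize P υ) (specialize A υ)) n := by
  change ((MvPolynomial.aeval υ : MvPolynomial (Fin k) K →ₐ[K] R) :
    MvPolynomial (Fin k) K →+* R) _ = _
  rw [RingHom.map_det, hankelMinor]
  congr 1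
  ext1 i j
  rw [RingHom.mapMatrix_apply, Matrix.map_apply, Matrix.submatrix_apply, hermiteMatrix,
    Matrix.of_apply, Matrix.of_apply, map_trace_mk _ hP, traceFunctional_apply,
    Polynomial.map_mul, Polynomial.map_pow, map_X]
  rfl

variable [LinearOrder R]

theorem sign_hankelMinor_specialize_eq {P : (MvPolynomial (Fin k) K)[X]} (hP : P.Monic)
    {τ : SignCondition (ThElim P)} {υ υ' : Fin k → R} (hυ : υ ∈ realization R τ)
    (hυ' : υ' ∈ realization R τ) (a : Finset.Icc 1 (P.natDegree - 1) → Fin 3)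
    (ha : (Finset.univ.filter fun h => a h ≠ 0).card ≤ Nat.size P.natDegree) {n : ℕ}
    (hn : n ≤ P.natDegree) :
    SignType.sign (hankelMinor (traceFunctional (specialize P υ)
      (derProd P.natDegree (specialize P υ) a)) n) =
        SignType.sign (hankelMinor (traceFunctional (specialize P υ')
          (derProd P.natDegree (specialize P υ') a)) n) := by
  rcases Nat.eq_zero_or_pos n with rfl | hpos
  -- The minor of size 0 is not in the elimination family, but it is the constant 1.
  · rw [hankelMinor_zero, hankelMinor_zero]
  have hmem : ((hermiteMatrix P (derProd P.natDegree P a)).submatrix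
      (Fin.castLE hn) (Fin.castLE hn)).det ∈ ThElim P :=
    Set.mem_biUnion (show derProd P.natDegree P a ∈ PDer (Nat.size P.natDegree) P from
      ⟨a, ha, rfl⟩) ⟨n, hpos, hn, rfl⟩
  have h1 := hυ ⟨_, hmem⟩
  have h2 := hυ' ⟨_, hmem⟩
  rw [aeval_hermiteMatrix_minor hP] at h1 h2
  have hder : ∀ υ : Fin k → R, specialize (derProd P.natDegree P a) υ =
      derProd P.natDegree (specialize P υ) a := fun υ => map_derProd _ _ _ _
  rw [hder] at h1 h2
  rw [h1, h2]

end Specialization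

end ThomFix

theorem mainTheorem7 {K R : Type*} [Field K] [Field R] [LinearOrder R] [IsStrictOrderedRing R]
    [IsRealClosed R] [Algebra K R] {k : ℕ} (p : ℕ) (hp : 1 ≤ p)
    (P : Polynomial (MvPolynomial (Fin k) K)) (hP : P.Monic) (hdeg : P.natDegree = p)
    (τ : ThomFix.SignCondition (ThomFix.ThElim P))
    (hτ : (ThomFix.realization R τ).Nonempty) :
    ∃! d : List ℕ × List ℕ × List (ThomFix.DerSign p),
      (∃ m n : ℕ, d.1 ∈ ThomFix.Lam m ∧ d.2.1 ∈ ThomFix.Lam n ∧ m + 2 * n = p) ∧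
      d.2.2.length = d.1.length ∧ d.2.2.Nodup ∧ d.2.2.Pairwise ThomFix.ThomMuLT ∧
      ∀ υ ∈ ThomFix.realization R τ,
        ∃ (θ : Fin d.1.length → R) (α β : Fin d.2.1.length → R),
          ThomFix.ThSystem (ThomFix.specialize P υ) d.1 d.2.1 d.2.2 θ α β := by
  subst hdeg
  obtain ⟨υ₀, hυ₀⟩ := hτ
  have hmonic : ∀ υ : Fin k → R, (ThomFix.specialize P υ).Monic := fun υ => hP.map _
  have hnd : ∀ υ : Fin k → R, (ThomFix.specialize P υ).natDegree = P.natDegree :=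
    fun υ => hP.natDegree_map _
  -- Comparing data at two possibly different points gives both claims: constancy over the
  -- realization, and uniqueness on taking the same point twice.
  have huniq : ∀ υ ∈ ThomFix.realization R τ, ∀ υ' ∈ ThomFix.realization R τ,
      ∀ {μ ν μ' ν' : List ℕ} {η η' : List (ThomFix.DerSign P.natDegree)},
      ThomFix.IsThomData (ThomFix.specialize P υ) μ ν η →
      ThomFix.IsThomData (ThomFix.specialize P υ') μ' ν' η' → μ = μ' ∧ ν = ν' ∧ η = η' :=
    fun υ hυ υ' hυ' _ _ _ _ _ _ h h' => h.eq_of_hankelMinor_sign_eq hp (hmonic υ) (hmonic υ')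
      (hnd υ) (hnd υ') h' fun a ha n hn =>
        ThomFix.sign_hankelMinor_specialize_eq hP hυ hυ' a ha hn
  obtain ⟨μ, ν, η, hdata⟩ := ThomFix.exists_thSystem (hmonic υ₀) (hnd υ₀) hp
  refine ⟨(μ, ν, η), ⟨hdata.1, hdata.2.1, hdata.2.2.1, hdata.2.2.2.1, fun υ hυ => ?_⟩, ?_⟩
  · obtain ⟨μ', ν', η', hdata'⟩ := ThomFix.exists_thSystem (hmonic υ) (hnd υ) hp
    obtain ⟨rfl, rfl, rfl⟩ := huniq υ₀ hυ₀ υ hυ hdata hdata'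
    exact hdata'.2.2.2.2
  · rintro ⟨μ', ν', η'⟩ ⟨h1, h2, h3, h4, h5⟩
    obtain ⟨rfl, rfl, rfl⟩ := huniq υ₀ hυ₀ υ₀ hυ₀ hdata ⟨h1, h2, h3, h4, h5 υ₀ hυ₀⟩
    rfl
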